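/- **Conventions.** A *simplicial complex* is a finite family $\Sigma$ of finite sets of integers (faces) with $\emptyset\in\Sigma$ that is closed under taking subsets. A face $F$ has dimension $|F|-1$; $\Sigma_i$ is the set of $i$-dimensional faces; $\dim\Sigma$ is the largest dimension of a face; the vertices of $\Sigma$ are the integers $v$ with $\{v\}\in\Sigma$. $\Sigma$ is *shifted* on the integer interval $[a,b]$ if every face is a subset of $[a,b]$ and, whenever $a\le i<j$, $F\in\Sigma$, $i\notin F$, $j\in F$, then $(F\setminus\{j\})\cup\{i\}\in\Sigma$. The pure $i$-skeleton is $\Sigma_{[i]}=\{F\in\Sigma: F\subseteq G\text{ for some }G\in\Sigma_i\}$. Further, $\mathrm{del}_p\Sigma=\{F\setminus\{p\}:F\in\Sigma\}$, $\mathrm{link}_p\Sigma=\{F: p\notin F,\ F\cup\{p\}\in\Sigma\}$, and $\tilde\beta_i$ is the $i$-th reduced Betti number (the rank of $\tilde H_i(\,\cdot\,;\mathbb Z)$). Let $K$ be a field of characteristic $0$, let $x_{k,v}$ $(k,v\in\mathbb Z)$ be indeterminates, and let $\Bbbk=K(x_{k,v})$. Let $\uparrow$ be the $K$-automorphism of $\Bbbk$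 with $\uparrow x_{k,v}=x_{k+1,v}$. For a multiset $S=\{i_1\le\dots\le i_m\}$ of integers put $x_S=x_{1,i_1}\cdots x_{m,i_m}$ and $X_S=x_S^2$. For multisets $S,T$ put $$z(S,T)=\frac1{\uparrow X_S}\sum_{j\in T}X_{S\cup j}\qquad(\cup\text{ the multiset union, adding multiplicities}).$$ For a complex $\Omega$ of dimension $e$, let $C_i(\Omega)$ be the $\Bbbk$-vector space with basis $\{[F]:F\in\Omega_i\}$, and set $$\partial_i[F]=\sum_{j\in F}\varepsilon(j,F)\frac{\uparrow^{e-i}x_F}{\uparrow^{e-i+1}x_{F\setminus j}}[F\setminus j],\qquad \partial^*_{i+1}[F]=\sum_{j\notin F,\ F\cup j\in\Omega}\varepsilon(j,F\cup j)\frac{\uparrow^{e-i-1}x_{F\cup j}}{\uparrow^{e-i}x_F}[F\cup j]\qquad(F\in\Omega_i),$$ where $\varepsilon(v,F)=(-1)^{k+1}$ if $v$ is the $k$-th smallest element of $F$. Let $\mathbf s_i(\Omega)$ be the multiset of eigenvalues, in an algebraic closure of $\Bbbk$ and with multiplicity, of the algebraic finely weighted up-down Laplacian $\partial_{i+1}\partial^*_{i+1}$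 on $C_i(\Omega)$. Write $\overset{\circ}{=}$ for equality of multisets up to the multiplicity of $0$. **Theorem 7.2.** Let $\Sigma$ be a shifted simplicial complex of dimension $d$ on an integer interval. 1. For every integer $i$, every nonzero element of $\mathbf s_{i-1}(\Sigma)$ equals $\uparrow^{d-i}z(S,T)$ for some sets $S,T$ of vertices of $\Sigma$. 2. If $\Sigma$ has no vertices, then $\mathbf s_{i-1}(\Sigma)$ has no nonzero elements, for every integer $i$. 3. Let $0\le i\le d$. Then $\Sigma_{[i]}$ has a smallest vertex $p$. Put $\Delta=\mathrm{del}_p\,\Sigma_{[i]}$ and $\Lambda=\mathrm{link}_p\,\Sigma_{[i]}$, and write $\tilde S=S\cup\{p\}$, $\tilde T=T\cup\{p\}$. The nonzero elements of $\mathbf s_{i-1}(\Delta)$ can be written, with multiplicity, as $z(S,T)$ with $S,T$ sets of vertices of $\Delta$, and those of $\mathbf s_{i-2}(\Lambda)$ as $z(S,T)$ with $S,T$ sets of vertices of $\Lambda$. For every way of writing these nonzero eigenvalues, with multiplicity, as $z(S,T)$ with $S,T$ finite sets of integers greater than $p$, $$\mathbf s_{i-1}(\Sigma)\overset{\circ}{=}\{\uparrow^{d-i}z(S,\tilde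 T): 0\ne z(S,T)\in\mathbf s_{i-1}(\Delta)\}\ \cup\ \{\uparrow^{d-i}z(\tilde S,\tilde T): 0\ne z(S,T)\in\mathbf s_{i-2}(\Lambda)\}\ \cup\ \{\uparrow^{d-i}z(\emptyset,\{p\})\}^{\tilde\beta_{i-1}(\Delta)},$$ where $\cup$ is the multiset union and the exponent is a multiplicity. -/

import Mathlib

/-!
Finite simplicial complexes on integer vertices, shifted complexes, the algebraic finely weighted
up-down Laplacian, its spectrum, and z-polynomials.

A complex is a finite family of finite sets of integers that contains the empty set and is closed
under taking subsets.  Dimensions are integers: the empty face has dimension `-1`.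
-/

namespace FineShifted

noncomputable section

/-- A simplicial complex: the empty set is a face and subsets of faces are faces. -/
structure IsSimplicialComplex (C : Finset (Finset ℤ)) : Prop where
  empty_mem : ∅ ∈ C
  down_closed : ∀ F ∈ C, ∀ G ⊆ F, G ∈ C

/-- `C` is a shifted simplicial complex on the vertex set `[a, b] = {a, a + 1, …, b}`. -/
structure IsShiftedComplex (C : Finset (Finset ℤ)) (a b : ℤ) : Prop
    extends IsSimplicialComplex C where
  subset_interval : ∀ F ∈ C, F ⊆ Finset.Icc a b
  exchange : ∀ F ∈ C, ∀ i j : ℤ, a ≤ i → i < j → i ∉ F → j ∈ F → insert i (F.erase j) ∈ C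

/-- The vertices of a complex, as the integers `v` such that `{v}` is a face. -/
def vertices (C : Finset (Finset ℤ)) : Set ℤ := {v | {v} ∈ C}

/-- The dimension of a complex: the largest dimension `|F| - 1` of a face. -/
def dimension (C : Finset (Finset ℤ)) : ℤ := ((C.sup Finset.card : ℕ) : ℤ) - 1

/-- The set of `i`-dimensional faces. -/
def facesOfDim (C : Finset (Finset ℤ)) (i : ℤ) : Finset (Finset ℤ) :=
  C.filter fun F => (F.card : ℤ) = i + 1

/-- The pure `i`-skeleton: the subcomplex generated by the `i`-dimensional faces. -/
def pureSkeleton (C : Finset (Finset ℤ)) (i : ℤ) : Finset (Finset ℤ) :=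
  C.filter fun F => ∃ G ∈ facesOfDim C i, F ⊆ G

/-- The deletion `{F \ {p} : F ∈ C}`. -/
def deletion (C : Finset (Finset ℤ)) (p : ℤ) : Finset (Finset ℤ) :=
  C.image fun F => F.erase p

/-- The link `{F : p ∉ F, F ∪ {p} ∈ C}`; as `C` is closed under subsets, such an `F` is in `C`. -/
def link (C : Finset (Finset ℤ)) (p : ℤ) : Finset (Finset ℤ) :=
  C.filter fun F => p ∉ F ∧ insert p F ∈ C

/-- The sign `(-1) ^ (k + 1)` where `v` is the `k`-th smallest element of `F`; zero if `v ∉ F`. -/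
def sgn (v : ℤ) (F : Finset ℤ) : ℤ :=
  if v ∈ F then (-1) ^ (F.filter fun u => u < v).card else 0

/-- The matrix of the (unweighted) simplicial boundary map `∂_{i+1} : C_{i+1} → C_i` over `ℤ`,
`[G] ↦ ∑_{j ∈ G} ε(j, G) [G \ j]`.  Columns are indexed by the `(i+1)`-dimensional faces and rows by
the `i`-dimensional faces. -/
def boundary (C : Finset (Finset ℤ)) (i : ℤ) :
    Matrix (facesOfDim C i) (facesOfDim C (i + 1)) ℤ :=
  fun F G => ∑ j ∈ G.1, if G.1.erase j = F.1 then sgn j G.1 else 0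

/-- The `(i+1)`-st reduced simplicial homology group over `ℤ`, `ker ∂_{i+1} / im ∂_{i+2}`. -/
abbrev reducedHomologySucc (C : Finset (Finset ℤ)) (i : ℤ) : Type :=
  LinearMap.ker (boundary C i).mulVecLin ⧸
    (LinearMap.range (boundary C (i + 1)).mulVecLin).submoduleOf
      (LinearMap.ker (boundary C i).mulVecLin)

/-- The `(i+1)`-st reduced Betti number: the rank of the `(i+1)`-st reduced integral homology. -/
def bettiSucc (C : Finset (Finset ℤ)) (i : ℤ) : ℕ :=
  Module.finrank ℤ (reducedHomologySucc C i)

/-- The field of rational functions over `K` in the indeterminates `x_{k,v}`, for integers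
`k` and `v`. -/
abbrev RatFun (K : Type*) [Field K] : Type _ := FractionRing (MvPolynomial (ℤ × ℤ) K)

section Weights

variable (K : Type*) [Field K]

/-- The indeterminate `x_{k,v}`. -/
def x (k v : ℤ) : RatFun K := algebraMap (MvPolynomial (ℤ × ℤ) K) (RatFun K) (MvPolynomial.X (k, v))

/-- The raising operator: the automorphism of the field of rational functions with
`x_{k,v} ↦ x_{k+1,v}` and fixing `K`. -/
def raise : RatFun K ≃+* RatFun K :=
  IsFractionRing.ringEquivOfRingEquiv
    (MvPolynomial.renameEquiv K
      ((Equiv.addRight (1 : ℤ)).prodCongr (Equiv.refl ℤ))).toRingEquiv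

/-- The `a`-th iterate of the raising operator. -/
def raisePow (a : ℤ) (r : RatFun K) : RatFun K := (raise K ^ a : RingAut (RatFun K)) r

/-- `x_S = x_{1,i_1} x_{2,i_2} ⋯ x_{m,i_m}` for the multiset `S = {i_1 ≤ i_2 ≤ ⋯ ≤ i_m}`. -/
def xMon (S : Multiset ℤ) : RatFun K :=
  (S.sort.mapIdx fun k v => x K ((k : ℤ) + 1) v).prod

/-- `X_S = x_S ^ 2`. -/
def XMon (S : Multiset ℤ) : RatFun K := xMon K S ^ 2

/-- The Laurent polynomial `z(S, T) = (1 / ↑X_S) ∑_{j ∈ T} X_{S ∪ j}`, where `S ∪ j` is a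
multiset union, so that the multiplicity of `j` goes up by one. -/
def zPoly (S T : Multiset ℤ) : RatFun K :=
  (raisePow K 1 (XMon K S))⁻¹ * (T.map fun j => XMon K (j ::ₘ S)).sum

/-- The matrix of the algebraic finely weighted boundary map `C_{i+1} → C_i`: with `d` the dimension
of the complex, `[G] ↦ ∑_{j ∈ G} ε(j, G) (↑^{d-(i+1)} x_G / ↑^{d-(i+1)+1} x_{G \ j}) [G \ j]`. -/
def algBoundary (C : Finset (Finset ℤ)) (i : ℤ) :
    Matrix (facesOfDim C i) (facesOfDim C (i + 1)) (RatFun K) :=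
  fun F G => ∑ j ∈ G.1, if G.1.erase j = F.1 then
    (sgn j G.1 : RatFun K) *
      (raisePow K (dimension C - (i + 1)) (xMon K G.1.val) /
        raisePow K (dimension C - (i + 1) + 1) (xMon K (G.1.erase j).val))
    else 0

/-- The matrix of the algebraic finely weighted coboundary map `C_i → C_{i+1}`:
`[F] ↦ ∑_{j ∉ F} ε(j, F ∪ j) (↑^{d-i-1} x_{F ∪ j} / ↑^{d-i} x_F) [F ∪ j]`. -/
def algCoboundary (C : Finset (Finset ℤ)) (i : ℤ) :
    Matrix (facesOfDim C (i + 1)) (facesOfDim C i) (RatFun K) :=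
  fun G F => ∑ j ∈ G.1 \ F.1, if insert j F.1 = G.1 then
    (sgn j G.1 : RatFun K) *
      (raisePow K (dimension C - i - 1) (xMon K G.1.val) /
        raisePow K (dimension C - i) (xMon K F.1.val))
    else 0

/-- The algebraic finely weighted up-down Laplacian on `i`-dimensional chains. -/
def upDownLaplacian (C : Finset (Finset ℤ)) (i : ℤ) :
    Matrix (facesOfDim C i) (facesOfDim C i) (RatFun K) :=
  algBoundary K C i * algCoboundary K C i

/-- The multiset of eigenvalues of the up-down Laplacian on `i`-dimensional chains, taken in an
algebraic closure of the field of rational functions, with multiplicity (as roots of the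
characteristic polynomial). -/
def upDownSpectrum (C : Finset (Finset ℤ)) (i : ℤ) : Multiset (AlgebraicClosure (RatFun K)) :=
  (upDownLaplacian K C i).charpoly.aroots (AlgebraicClosure (RatFun K))

/-- The rational function `r` as an element of the algebraic closure. -/
def emb (r : RatFun K) : AlgebraicClosure (RatFun K) := algebraMap _ _ r

end Weights

open Classical in
/-- The nonzero part of a multiset.  Two multisets agree up to the multiplicity of zero exactly if
their nonzero parts are equal. -/
def nonzeroPart {α : Type*} [Zero α] (M : Multiset α) : Multiset α := M.filter fun r => r ≠ 0

/-- Equality of multisets up to the multiplicity of zero. -/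
def EqUpToZero {α : Type*} [Zero α] (M N : Multiset α) : Prop := nonzeroPart M = nonzeroPart N

end

end FineShifted

open FineShifted

/-!
The `i`-dimensional faces of a shifted complex form a near-cone over the initial vertex `p`: the
weighted boundary map `W` on them factors, up to the scalar `x_{1,p}`, as `P * T` through the chains
on the link of `p`, where `P` is the restriction of `W` to the faces containing `p` and `T` is the
weighted boundary map from all the faces to the link. Now `T * Tᵀ` is `x_{1,p} ^ 2` plus the
up-down Laplacian `A` of the deletion, `Pᵀ * P` is `x_{1,p} ^ 2` plus a multiple `B` of the raised
down-up Laplacian of the link, and `A * B = 0` because a boundary has no boundary. Hence the nonzero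
eigenvalues of `W * Wᵀ` are those of `x_{1,p} ^ 2 + A + B`; on `z`-polynomials, adding `x_{1,p} ^ 2`
adjoins `p` to `T`, while raising and rescaling adjoins `p` to `S`. The common kernel of `A` and `B`
contributes `z(∅, {p}) = x_{1,p} ^ 2`, with the multiplicity that makes the number of nonzero
eigenvalues equal to the rank of `W`; the same count for the deletion identifies this multiplicity
as a Betti number.
-/

namespace FineShifted

open Finset
open scoped FinsetFamily Matrix

section NonzeroPart

variable {α β : Type*} [Zero α] [Zero β]

theorem nonzeroPart_eq_self {M : Multiset α} : nonzeroPart M = M ↔ 0 ∉ M := by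
  classical
  rw [nonzeroPart, Multiset.filter_eq_self]
  exact ⟨fun h h0 => h 0 h0 rfl, fun h r hr hr0 => h (hr0 ▸ hr)⟩

theorem zero_notMem_nonzeroPart (M : Multiset α) : 0 ∉ nonzeroPart M := by
  classical
  exact fun h => (Multiset.mem_filter.1 h).2 rfl

theorem nonzeroPart_add (M N : Multiset α) :
    nonzeroPart (M + N) = nonzeroPart M + nonzeroPart N := by
  classical
  exact Multiset.filter_add _ M N

theorem nonzeroPart_replicate_zero (k : ℕ) : nonzeroPart (Multiset.replicate k (0 : α)) = 0 := by
  classical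
  exact Multiset.filter_eq_nil.2 fun _ hr => not_not.2 (Multiset.eq_of_mem_replicate hr)

theorem exists_eq_nonzeroPart_add_replicate (M : Multiset α) :
    ∃ k, M = nonzeroPart M + Multiset.replicate k 0 := by
  classical
  have hzero : M.filter (fun r => ¬ r ≠ 0) = Multiset.replicate _ 0 :=
    Multiset.eq_replicate_card.2 fun r hr => not_not.1 (Multiset.mem_filter.1 hr).2
  exact ⟨_, hzero ▸ (Multiset.filter_add_not (fun r => r ≠ 0) M).symm⟩

theorem nonzeroPart_map {f : α → β} (hf : ∀ r, f r = 0 ↔ r = 0) (M : Multiset α) :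
    nonzeroPart (M.map f) = (nonzeroPart M).map f := by
  classical
  rw [nonzeroPart, nonzeroPart, Multiset.filter_map]
  exact congrArg _ (Multiset.filter_congr fun r _ => (hf r).not)

end NonzeroPart

section LinearAlgebra

open Polynomial

/-- The nonzero eigenvalues of the square matrix `M`, counted with algebraic multiplicity, all lie
in the base field and form the multiset `R`. -/
structure HasNonzeroEigenvalues {F n : Type*} [Field F] [Fintype n] [DecidableEq n]
    (M : Matrix n n F) (R : Multiset F) : Prop where
  splits : M.charpoly.Splits
  nonzeroPart_roots : nonzeroPart M.charpoly.roots = R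

variable {F n m : Type*} [Field F] [Fintype n] [DecidableEq n] [Fintype m] [DecidableEq m]

theorem splits_X_pow_mul {k : ℕ} {f : F[X]} : (X ^ k * f).Splits ↔ f.Splits := by
  rcases eq_or_ne f 0 with rfl | hf
  · simp
  · rw [splits_mul (pow_ne_zero _ X_ne_zero) hf]
    exact and_iff_right (Splits.X_pow k)

theorem nonzeroPart_roots_X_pow_mul {k : ℕ} {f : F[X]} :
    nonzeroPart (X ^ k * f).roots = nonzeroPart f.roots := by
  rcases eq_or_ne f 0 with rfl | hf
  · simp
  · rw [roots_mul (mul_ne_zero (pow_ne_zero _ X_ne_zero) hf), nonzeroPart_add, roots_X_pow,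
      Multiset.nsmul_singleton, nonzeroPart_replicate_zero, zero_add]

theorem splits_charpoly_iff_card_roots {M : Matrix n n F} :
    M.charpoly.Splits ↔ M.charpoly.roots.card = Fintype.card n := by
  rw [splits_iff_card_roots, Matrix.charpoly_natDegree_eq_dim]

theorem X_pow_mul_charpoly_add {R : Type*} [CommRing R] {A B : Matrix n n R} (hAB : A * B = 0) :
    X ^ Fintype.card n * (A + B).charpoly = A.charpoly * B.charpoly := by
  have hAB' : A.map C * B.map C = 0 := by
    rw [← Matrix.map_mul, hAB, Matrix.map_zero _ C_0]
  have hmul : A.charmatrix * B.charmatrix = (X : R[X]) • (A + B).charmatrix := by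
    simp only [Matrix.charmatrix, RingHom.mapMatrix_apply, Matrix.map_add _ fun _ _ => C_add]
    rw [Matrix.smul_eq_mul_diagonal, ← Matrix.scalar_apply]
    have hcomm := (Matrix.scalar_commute (X : R[X]) (Commute.all X) (B.map C)).eq
    simp only [sub_mul, mul_sub, add_mul, hAB', hcomm]
    abel
  rw [Matrix.charpoly, Matrix.charpoly, Matrix.charpoly, ← Matrix.det_mul, hmul, Matrix.det_smul]

theorem charpoly_smul_comp {R : Type*} [CommRing R] (c : R) (M : Matrix n n R) :
    (c • M).charpoly.comp (C c * X) = C (c ^ Fintype.card n) * M.charpoly := by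
  rw [Matrix.charpoly, Matrix.charpoly, ← coe_compRingHom_apply, RingHom.map_det, C_pow,
    ← Matrix.det_smul]
  congr 1
  ext1 i j
  rcases eq_or_ne i j with rfl | hij
  · simp [Matrix.charmatrix_apply_eq, mul_sub]
  · simp [Matrix.charmatrix_apply_ne _ _ _ hij]

theorem roots_charpoly_smul {c : F} (hc : c ≠ 0) (M : Matrix n n F) :
    (c • M).charpoly.roots = M.charpoly.roots.map (c * ·) := by
  have h := map_roots_comp_C_mul_X_add_C (c • M).charpoly c 0 (isUnit_iff_ne_zero.2 hc)
  simp only [C_0, add_zero, charpoly_smul_comp, roots_C_mul _ (pow_ne_zero _ hc)] at h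
  exact h.symm

theorem roots_charpoly_scalar_add (c : F) (M : Matrix n n F) :
    (Matrix.scalar n c + M).charpoly.roots = M.charpoly.roots.map (c + ·) := by
  have hsub : Matrix.scalar n c + M = M - Matrix.scalar n (-c) := by
    rw [map_neg, sub_neg_eq_add, add_comm]
  have h := roots_comp_C_mul_X_add_C M.charpoly 1 (-c) isUnit_one
  rw [C_1, one_mul, ← Matrix.charpoly_sub_scalar, ← hsub] at h
  simpa [add_comm] using h

namespace HasNonzeroEigenvalues

variable {M : Matrix n n F} {R S : Multiset F}

theorem roots_eq (h : HasNonzeroEigenvalues M R) :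
    ∃ k, R.card + k = Fintype.card n ∧ M.charpoly.roots = R + Multiset.replicate k 0 := by
  obtain ⟨k, hroots⟩ := exists_eq_nonzeroPart_add_replicate M.charpoly.roots
  rw [h.nonzeroPart_roots] at hroots
  refine ⟨k, ?_, hroots⟩
  rw [← splits_charpoly_iff_card_roots.1 h.splits, hroots, Multiset.card_add,
    Multiset.card_replicate]

theorem mul_comm {A : Matrix m n F} {B : Matrix n m F}
    (h : HasNonzeroEigenvalues (A * B) R) : HasNonzeroEigenvalues (B * A) R := by
  have hAB := Matrix.charpoly_mul_comm' A B
  refine ⟨?_, ?_⟩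
  · rw [← splits_X_pow_mul, ← hAB, splits_X_pow_mul]
    exact h.splits
  · rw [← nonzeroPart_roots_X_pow_mul, ← hAB, nonzeroPart_roots_X_pow_mul, h.nonzeroPart_roots]

theorem zero : HasNonzeroEigenvalues (0 : Matrix n n F) 0 where
  splits := by
    rw [Matrix.charpoly_zero]
    exact Splits.X_pow _
  nonzeroPart_roots := by
    rw [Matrix.charpoly_zero, roots_X_pow, Multiset.nsmul_singleton, nonzeroPart_replicate_zero]

theorem map {E : Type*} [Field E] (f : F →+* E) (h : HasNonzeroEigenvalues M R) :
    HasNonzeroEigenvalues (M.map f) (R.map f) where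
  splits := Matrix.charpoly_map M f ▸ h.splits.map f
  nonzeroPart_roots := by
    rw [Matrix.charpoly_map, h.splits.roots_map, nonzeroPart_map fun r => map_eq_zero f,
      h.nonzeroPart_roots]

theorem smul {c : F} (hc : c ≠ 0) (h : HasNonzeroEigenvalues M R) :
    HasNonzeroEigenvalues (c • M) (R.map (c * ·)) where
  splits := by
    rw [splits_charpoly_iff_card_roots, roots_charpoly_smul hc, Multiset.card_map,
      splits_charpoly_iff_card_roots.1 h.splits]
  nonzeroPart_roots := by
    rw [roots_charpoly_smul hc, nonzeroPart_map fun r => by simp [hc], h.nonzeroPart_roots]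

theorem add_of_mul_eq_zero {A B : Matrix n n F} (hAB : A * B = 0)
    (hA : HasNonzeroEigenvalues A R) (hB : HasNonzeroEigenvalues B S) :
    HasNonzeroEigenvalues (A + B) (R + S) where
  splits := by
    rw [← splits_X_pow_mul, X_pow_mul_charpoly_add hAB]
    exact hA.splits.mul hB.splits
  nonzeroPart_roots := by
    rw [← nonzeroPart_roots_X_pow_mul, X_pow_mul_charpoly_add hAB,
      roots_mul (mul_ne_zero A.charpoly_monic.ne_zero B.charpoly_monic.ne_zero), nonzeroPart_add,
      hA.nonzeroPart_roots, hB.nonzeroPart_roots]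

theorem scalar_add {c : F} (hc : c ≠ 0) (h : HasNonzeroEigenvalues M R)
    (hR : ∀ r ∈ R, c + r ≠ 0) :
    ∃ k, R.card + k = Fintype.card n ∧
      HasNonzeroEigenvalues (Matrix.scalar n c + M) (R.map (c + ·) + Multiset.replicate k c) := by
  obtain ⟨k, hk, hroots⟩ := h.roots_eq
  refine ⟨k, hk, ?_, ?_⟩
  · rw [splits_charpoly_iff_card_roots, roots_charpoly_scalar_add, Multiset.card_map,
      splits_charpoly_iff_card_roots.1 h.splits]
  · rw [roots_charpoly_scalar_add, hroots, Multiset.map_add, Multiset.map_replicate, add_zero,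
      nonzeroPart_eq_self]
    simp only [Multiset.mem_add, Multiset.mem_map, not_or, not_exists, not_and]
    exact ⟨hR, fun h0 => hc (Multiset.eq_of_mem_replicate h0).symm⟩

omit [DecidableEq n] in
theorem mul_transpose_of_factorization {l : Type*} [Fintype l] [DecidableEq l] {W : Matrix m n F}
    {P : Matrix m l F} {T : Matrix l n F} {A B : Matrix l l F} {c : F} (hc : c ≠ 0)
    (hW : P * T = c • W) (hP : Pᵀ * P = Matrix.scalar l (c ^ 2) + B)
    (hT : T * Tᵀ = Matrix.scalar l (c ^ 2) + A) (hAB : A * B = 0)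
    (hA : HasNonzeroEigenvalues A R) (hB : HasNonzeroEigenvalues B S)
    (hRS : ∀ r ∈ R + S, c ^ 2 + r ≠ 0) :
    ∃ k, R.card + S.card + k = Fintype.card l ∧
      HasNonzeroEigenvalues (W * Wᵀ)
        ((R + S).map (c ^ 2 + ·) + Multiset.replicate k (c ^ 2)) := by
  have hc2 : c ^ 2 ≠ 0 := pow_ne_zero 2 hc
  have hWW : W * Wᵀ = ((c ^ 2)⁻¹ • P) * (T * Tᵀ * Pᵀ) := by
    rw [← inv_smul_eq_iff₀ hc] at hW
    simp only [← hW, Matrix.transpose_smul, Matrix.transpose_mul, Matrix.smul_mul,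
      Matrix.mul_smul, smul_smul, ← pow_two, inv_pow, Matrix.mul_assoc]
  have hTP : (T * Tᵀ * Pᵀ) * ((c ^ 2)⁻¹ • P) = Matrix.scalar l (c ^ 2) + (A + B) := by
    have hscalar (M : Matrix l l F) : Matrix.scalar l (c ^ 2) * M = c ^ 2 • M := by
      rw [Matrix.scalar_apply, Matrix.smul_eq_diagonal_mul]
    have hcomm : A * Matrix.scalar l (c ^ 2) = c ^ 2 • A := by
      rw [← hscalar, (Matrix.scalar_commute (c ^ 2) (Commute.all _) A).eq]
    rw [Matrix.mul_smul, Matrix.mul_assoc, hP, hT, inv_smul_eq_iff₀ hc2, add_mul, mul_add A, hAB,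
      add_zero, hcomm, hscalar, ← smul_add, add_assoc, add_comm B]
  obtain ⟨k, hk, hadd⟩ := scalar_add hc2 (add_of_mul_eq_zero hAB hA hB) hRS
  refine ⟨k, by rwa [Multiset.card_add] at hk, ?_⟩
  rw [hWW]
  exact mul_comm (hTP ▸ hadd)

theorem nonzeroPart_aroots {E : Type*} [Field E] [Algebra F E]
    (h : HasNonzeroEigenvalues M R) :
    nonzeroPart (M.charpoly.aroots E) = R.map (algebraMap F E) := by
  rw [aroots, ← Matrix.charpoly_map]
  exact (h.map (algebraMap F E)).nonzeroPart_roots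

end HasNonzeroEigenvalues

end LinearAlgebra

section Incidence

/-- The coefficient of the face `E` in the simplicial boundary of the face `G`. -/
def incidence (E G : Finset ℤ) : ℤ := ∑ j ∈ G, if G.erase j = E then sgn j G else 0

theorem exists_erase_eq_of_incidence_ne_zero {E G : Finset ℤ} (h : incidence E G ≠ 0) :
    ∃ j ∈ G, G.erase j = E := by
  obtain ⟨j, hj, hne⟩ := exists_ne_zero_of_sum_ne_zero h
  exact ⟨j, hj, (ite_ne_right_iff.1 hne).1⟩

theorem incidence_eq_zero_of_not_subset {E G : Finset ℤ} (h : ¬ E ⊆ G) : incidence E G = 0 := by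
  by_contra hne
  obtain ⟨j, -, rfl⟩ := exists_erase_eq_of_incidence_ne_zero hne
  exact h (erase_subset j G)

theorem incidence_erase {G : Finset ℤ} {j : ℤ} (hj : j ∈ G) :
    incidence (G.erase j) G = sgn j G := by
  rw [incidence, sum_eq_single_of_mem j hj, if_pos rfl]
  exact fun k hk hkj => if_neg fun h => hkj (erase_injOn G hk hj h)

theorem sum_mul_incidence {𝓕 : Finset (Finset ℤ)} {G : Finset ℤ} (h𝓕 : ∀ j ∈ G, G.erase j ∈ 𝓕)
    (f : Finset ℤ → ℤ) :
    ∑ F ∈ 𝓕, f F * incidence F G = ∑ j ∈ G, f (G.erase j) * sgn j G := by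
  rw [← sum_subset (image_subset_iff.2 h𝓕 : G.image G.erase ⊆ 𝓕), sum_image (erase_injOn G)]
  · exact sum_congr rfl fun j hj => by rw [incidence_erase hj]
  · intro F _ hF
    by_contra h
    obtain ⟨j, hj, rfl⟩ := exists_erase_eq_of_incidence_ne_zero (right_ne_zero_of_mul h)
    exact hF (mem_image_of_mem _ hj)

theorem sgn_of_mem {v : ℤ} {F : Finset ℤ} (hv : v ∈ F) : sgn v F = (-1) ^ #{u ∈ F | u < v} :=
  if_pos hv

theorem sgn_of_notMem {v : ℤ} {F : Finset ℤ} (hv : v ∉ F) : sgn v F = 0 := if_neg hv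

theorem sgn_erase_of_lt {G : Finset ℤ} {j k : ℤ} (hjk : j < k) : sgn j (G.erase k) = sgn j G := by
  have hfilter : {u ∈ G.erase k | u < j} = {u ∈ G | u < j} := by
    rw [filter_erase, erase_eq_of_notMem]
    exact fun h => hjk.not_gt (mem_filter.1 h).2
  rw [sgn, sgn, hfilter]
  simp only [mem_erase, hjk.ne, ne_eq, not_false_eq_true, true_and]

theorem sgn_insert_of_lt {F : Finset ℤ} {p j : ℤ} (hp : p ∉ F) (hpj : p < j) :
    sgn j (insert p F) = -sgn j F := by
  by_cases hj : j ∈ F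
  · rw [sgn_of_mem (mem_insert_of_mem hj), sgn_of_mem hj, filter_insert, if_pos hpj,
      card_insert_of_notMem fun h => hp (mem_filter.1 h).1, pow_succ, mul_neg_one]
  · rw [sgn_of_notMem hj, sgn_of_notMem fun h => (mem_insert.1 h).elim hpj.ne' hj, neg_zero]

theorem sgn_erase_mul_sgn (G : Finset ℤ) (j k : ℤ) :
    sgn k (G.erase j) * sgn j G = -(sgn j (G.erase k) * sgn k G) := by
  wlog hjk : j < k generalizing j k
  · rcases (not_lt.1 hjk).lt_or_eq with hkj | rfl
    · rw [this k j hkj, neg_neg]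
    · rw [sgn_of_notMem (notMem_erase k G), zero_mul, neg_zero]
  by_cases hj : j ∈ G
  · have hsgn := sgn_insert_of_lt (notMem_erase j G) hjk
    rw [insert_erase hj] at hsgn
    rw [sgn_erase_of_lt hjk, hsgn]
    ring
  · rw [sgn_of_notMem hj, sgn_of_notMem fun h => hj (mem_of_mem_erase h), zero_mul, mul_zero,
      neg_zero]

theorem sum_incidence_mul_incidence {𝓕 : Finset (Finset ℤ)} {G : Finset ℤ}
    (h𝓕 : ∀ j ∈ G, G.erase j ∈ 𝓕) (E : Finset ℤ) :
    ∑ F ∈ 𝓕, incidence E F * incidence F G = 0 := by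
  let f (j k : ℤ) : ℤ := if (G.erase j).erase k = E then sgn k (G.erase j) * sgn j G else 0
  have hf (j k : ℤ) : f j k = -f k j := by
    simp only [f, erase_right_comm (a := j), sgn_erase_mul_sgn G j k]
    split_ifs <;> simp
  have hsum (j : ℤ) : incidence E (G.erase j) * sgn j G = ∑ k ∈ G, f j k := by
    rw [incidence, sum_mul]
    simp only [ite_mul, zero_mul]
    exact sum_subset (erase_subset j G) fun k _ hk => by
      rw [sgn_of_notMem hk, zero_mul, ite_self]
  have hanti : ∑ j ∈ G, ∑ k ∈ G, f j k = -∑ j ∈ G, ∑ k ∈ G, f j k := by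
    conv_lhs => rw [sum_comm]
    simp only [← sum_neg_distrib, ← hf]
  rw [sum_mul_incidence h𝓕, sum_congr rfl fun j _ => hsum j]
  exact self_eq_neg.1 hanti

variable {p : ℤ} {E F : Finset ℤ}

theorem incidence_insert_of_notMem (hE : p ∉ E) (hF : ∀ v ∈ F, p < v) :
    incidence E (insert p F) = if E = F then 1 else 0 := by
  have hp : p ∉ F := fun h => (hF p h).false
  split_ifs with h
  · subst h
    have hinc := incidence_erase (mem_insert_self p E)
    rwa [erase_insert hp, sgn_of_mem (mem_insert_self p E), filter_eq_empty_iff.2, card_empty,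
      pow_zero] at hinc
    exact fun v hv => (mem_insert.1 hv).elim (fun h => h ▸ lt_irrefl p) fun h => (hF v h).not_gt
  · by_contra hne
    obtain ⟨j, -, hjE⟩ := exists_erase_eq_of_incidence_ne_zero hne
    rcases eq_or_ne j p with rfl | hjp
    · exact h (by rw [← hjE, erase_insert hp])
    · exact hE (hjE ▸ mem_erase.2 ⟨hjp.symm, mem_insert_self p F⟩)

theorem incidence_insert_insert (hE : p ∉ E) (hF : ∀ v ∈ F, p < v) :
    incidence (insert p E) (insert p F) = -incidence E F := by
  have hp : p ∉ F := fun h => (hF p h).false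
  have hne : F ≠ insert p E := fun h => hp (h ▸ mem_insert_self p E)
  rw [incidence, incidence, sum_insert hp, ← sum_neg_distrib, erase_insert hp, if_neg hne,
    zero_add]
  refine sum_congr rfl fun j hj => ?_
  have hiff : insert p (F.erase j) = insert p E ↔ F.erase j = E :=
    ⟨fun h => by
      rw [← erase_insert hE, ← h, erase_insert fun h' => hp (mem_of_mem_erase h')],
      fun h => h ▸ rfl⟩
  rw [erase_insert_of_ne (hF j hj).ne, sgn_insert_of_lt hp (hF j hj)]
  simp only [hiff]
  split_ifs <;> simp

end Incidence

section MemberSubfamily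

variable {α : Type*} [DecidableEq α] {p : α} {𝓖 : Finset (Finset α)}

theorem memberSubfamily_subset_shadow : 𝓖.memberSubfamily p ⊆ ∂ 𝓖 := fun _ hF =>
  have hF := mem_memberSubfamily.1 hF
  mem_shadow_iff_insert_mem.2 ⟨p, hF.2, hF.1⟩

theorem erase_mem_memberSubfamily_of_mem {G : Finset α} (hG : G ∈ 𝓖) (hp : p ∈ G) :
    G.erase p ∈ 𝓖.memberSubfamily p := by
  rw [mem_memberSubfamily, insert_erase hp]
  exact ⟨hG, notMem_erase p G⟩

theorem sum_memberSubfamily_add_sum_nonMemberSubfamily {M : Type*} [AddCommMonoid M]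
    (p : α) (𝓖 : Finset (Finset α)) (f : Finset α → M) :
    ∑ F ∈ 𝓖.memberSubfamily p, f (insert p F) + ∑ G ∈ 𝓖.nonMemberSubfamily p, f G =
      ∑ G ∈ 𝓖, f G := by
  rw [← sum_filter_add_sum_filter_not 𝓖 (p ∈ ·), ← image_insert_memberSubfamily, sum_image]
  · rfl
  · intro F hF F' hF' h
    rw [← erase_insert (mem_memberSubfamily.1 hF).2, h,
      erase_insert (mem_memberSubfamily.1 hF').2]

end MemberSubfamily

section NearCone

variable {p : ℤ} {𝓔 𝓖 : Finset (Finset ℤ)}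

/-- A near-cone with apex `p`, as a family of faces of one dimension: no element of a member lies
below `p`, and every element of a member that misses `p` can be exchanged for `p`. -/
structure IsNearCone (p : ℤ) (𝓖 : Finset (Finset ℤ)) : Prop where
  le : ∀ G ∈ 𝓖, ∀ v ∈ G, p ≤ v
  insert_erase_mem : ∀ G ∈ 𝓖, p ∉ G → ∀ j ∈ G, insert p (G.erase j) ∈ 𝓖

/-- The matrix of the boundary map from chains on `𝓖` to chains on `𝓔`. -/
def incidenceMatrix (𝓔 𝓖 : Finset (Finset ℤ)) : Matrix 𝓔 𝓖 ℤ := .of fun E G => incidence E G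

/-- The face `insert p F` of `𝓖` over the face `F` of its link. -/
def coneFace (p : ℤ) (𝓖 : Finset (Finset ℤ)) (F : 𝓖.memberSubfamily p) : 𝓖 :=
  ⟨insert p F, (mem_memberSubfamily.1 F.2).1⟩

namespace IsNearCone

variable (h : IsNearCone p 𝓖)
include h

theorem lt_of_mem_memberSubfamily {F : Finset ℤ} (hF : F ∈ 𝓖.memberSubfamily p) :
    ∀ v ∈ F, p < v := fun v hv =>
  have hF := mem_memberSubfamily.1 hF
  (h.le _ hF.1 v (mem_insert_of_mem hv)).lt_of_ne fun e => hF.2 (e ▸ hv)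

theorem erase_mem_memberSubfamily {G : Finset ℤ} (hG : G ∈ 𝓖.nonMemberSubfamily p) {j : ℤ}
    (hj : j ∈ G) : G.erase j ∈ 𝓖.memberSubfamily p :=
  have hG := mem_nonMemberSubfamily.1 hG
  mem_memberSubfamily.2 ⟨h.insert_erase_mem G hG.1 hG.2 j hj, fun h' =>
    hG.2 (mem_of_mem_erase h')⟩

theorem mem_memberSubfamily_of_incidence_ne_zero {E G : Finset ℤ} (hG : G ∈ 𝓖) (hE : p ∉ E)
    (hne : incidence E G ≠ 0) : E ∈ 𝓖.memberSubfamily p := by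
  obtain ⟨j, hj, rfl⟩ := exists_erase_eq_of_incidence_ne_zero hne
  by_cases hp : p ∈ G
  · rcases eq_or_ne j p with rfl | hjp
    · exact erase_mem_memberSubfamily_of_mem hG hp
    · exact (hE (mem_erase.2 ⟨hjp.symm, hp⟩)).elim
  · exact h.erase_mem_memberSubfamily (mem_nonMemberSubfamily.2 ⟨hG, hp⟩) hj

theorem sum_incidence_mul_incidence_insert {F : Finset ℤ} (hF : F ∈ 𝓖.memberSubfamily p)
    (f : Finset ℤ → ℤ) :
    ∑ F' ∈ 𝓖.memberSubfamily p, f F' * incidence F' (insert p F) = f F := by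
  rw [sum_eq_single_of_mem F hF, incidence_insert_of_notMem (mem_memberSubfamily.1 hF).2
    (h.lt_of_mem_memberSubfamily hF), if_pos rfl, mul_one]
  intro F' hF' hne
  rw [incidence_insert_of_notMem (mem_memberSubfamily.1 hF').2 (h.lt_of_mem_memberSubfamily hF),
    if_neg hne, mul_zero]

/-- The boundary map of a near-cone factors through the chains on the link of its apex: the cone
over a chain `c` on the link has boundary `c` minus the cone over the boundary of `c`. -/
theorem sum_incidence_insert_mul_incidence (E : Finset ℤ) {G : Finset ℤ} (hG : G ∈ 𝓖) :
    ∑ F ∈ 𝓖.memberSubfamily p, incidence E (insert p F) * incidence F G = incidence E G := by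
  by_cases hpG : p ∈ G
  · have hF := erase_mem_memberSubfamily_of_mem hG hpG
    have hsum := h.sum_incidence_mul_incidence_insert hF fun F => incidence E (insert p F)
    rwa [insert_erase hpG] at hsum
  have hG' : G ∈ 𝓖.nonMemberSubfamily p := mem_nonMemberSubfamily.2 ⟨hG, hpG⟩
  by_cases hpE : p ∈ E
  · have hinc : ∀ F ∈ 𝓖.memberSubfamily p, incidence E (insert p F) = -incidence (E.erase p) F :=
      fun F hF => by
        rw [← incidence_insert_insert (notMem_erase p E) (h.lt_of_mem_memberSubfamily hF),
          insert_erase hpE]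
    rw [incidence_eq_zero_of_not_subset fun h => hpG (h hpE),
      sum_congr rfl fun F hF => by rw [hinc F hF, neg_mul], sum_neg_distrib,
      sum_incidence_mul_incidence fun j hj => h.erase_mem_memberSubfamily hG' hj, neg_zero]
  · have hinc : ∀ F ∈ 𝓖.memberSubfamily p,
        incidence E (insert p F) * incidence F G = if E = F then incidence F G else 0 :=
      fun F hF => by
        rw [incidence_insert_of_notMem hpE (h.lt_of_mem_memberSubfamily hF), ite_mul, one_mul,
          zero_mul]
    rw [sum_congr rfl hinc, sum_ite_eq, ite_eq_left_iff]
    exact fun hE => (not_not.1 fun hne =>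
      hE (h.mem_memberSubfamily_of_incidence_ne_zero hG hpE (Ne.symm hne)))

theorem rank_incidenceMatrix (h𝓔 : ∂ 𝓖 ⊆ 𝓔) :
    (incidenceMatrix 𝓔 𝓖).rank = #(𝓖.memberSubfamily p) := by
  have hmul : incidenceMatrix 𝓔 𝓖 = (incidenceMatrix 𝓔 𝓖).submatrix id (coneFace p 𝓖) *
      incidenceMatrix (𝓖.memberSubfamily p) 𝓖 := by
    ext E G
    exact (h.sum_incidence_insert_mul_incidence E G.2).symm.trans (sum_coe_sort _ _).symm
  let ι : 𝓖.memberSubfamily p → 𝓔 := fun F => ⟨F, h𝓔 (memberSubfamily_subset_shadow F.2)⟩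
  have hone : (incidenceMatrix 𝓔 𝓖).submatrix ι (coneFace p 𝓖) = 1 := by
    ext F F'
    simp only [Matrix.one_apply, Subtype.ext_iff]
    exact incidence_insert_of_notMem (mem_memberSubfamily.1 F.2).2
      (h.lt_of_mem_memberSubfamily F'.2)
  apply le_antisymm
  · rw [hmul, ← Fintype.card_coe]
    exact (Matrix.rank_mul_le_left _ _).trans (Matrix.rank_le_card_width _)
  · rw [← Fintype.card_coe, ← Matrix.rank_one (R := ℤ), ← hone]
    exact Matrix.rank_submatrix_le _ _ _

end IsNearCone

end NearCone

section Weights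

variable (K : Type*) [Field K]

theorem raise_algebraMap (f : MvPolynomial (ℤ × ℤ) K) :
    raise K (algebraMap _ (RatFun K) f) =
      algebraMap _ (RatFun K) (MvPolynomial.rename (fun q => (q.1 + 1, q.2)) f) := by
  rw [raise, IsFractionRing.ringEquivOfRingEquiv_algebraMap]
  rfl

theorem raise_x (k v : ℤ) : raise K (x K k v) = x K (k + 1) v := by
  rw [x, raise_algebraMap, MvPolynomial.rename_X, x]

theorem raisePow_zero (r : RatFun K) : raisePow K 0 r = r := by
  rw [raisePow, zpow_zero, RingAut.one_apply]

theorem raisePow_one (r : RatFun K) : raisePow K 1 r = raise K r := by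
  rw [raisePow, zpow_one]

theorem raisePow_add_one (a : ℤ) (r : RatFun K) :
    raisePow K (a + 1) r = raisePow K a (raise K r) := by
  rw [raisePow, zpow_add_one, RingAut.mul_apply, raisePow]

theorem xMon_cons {p : ℤ} {S : Multiset ℤ} (h : ∀ v ∈ S, p ≤ v) :
    xMon K (p ::ₘ S) = x K 1 p * raise K (xMon K S) := by
  rw [xMon, Multiset.sort_cons _ _ _ h, List.mapIdx_cons, List.prod_cons, xMon, map_list_prod]
  congr 2
  exact List.ext_getElem (by simp) (by simp [raise_x])

theorem XMon_cons {p : ℤ} {S : Multiset ℤ} (h : ∀ v ∈ S, p ≤ v) :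
    XMon K (p ::ₘ S) = x K 1 p ^ 2 * raise K (XMon K S) := by
  rw [XMon, xMon_cons K h, mul_pow, ← map_pow, XMon]

/-- The monomial `x_S` as an element of the polynomial ring. -/
noncomputable def xPoly (S : Multiset ℤ) : MvPolynomial (ℤ × ℤ) K :=
  (S.sort.mapIdx fun k v => MvPolynomial.X ((k : ℤ) + 1, v)).prod

theorem algebraMap_xPoly (S : Multiset ℤ) :
    algebraMap (MvPolynomial (ℤ × ℤ) K) (RatFun K) (xPoly K S) = xMon K S := by
  rw [xPoly, xMon, map_list_prod]
  congr 1
  exact List.ext_getElem (by simp) (by simp [x])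

theorem rename_snd_xPoly (S : Multiset ℤ) :
    MvPolynomial.rename Prod.snd (xPoly K S) = (S.map (MvPolynomial.X (R := K))).prod := by
  conv_rhs => rw [← Multiset.sort_eq S (· ≤ ·), Multiset.map_coe, Multiset.prod_coe]
  rw [xPoly, map_list_prod]
  congr 1
  exact List.ext_getElem (by simp) (by simp)

theorem prod_map_X_ne_zero (S : Multiset ℤ) : (S.map (MvPolynomial.X (R := K))).prod ≠ 0 := by
  simp [Multiset.prod_eq_zero_iff]

theorem sum_X_sq_ne_zero {T : Finset ℤ} (hT : T.Nonempty) :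
    ∑ j ∈ T, (MvPolynomial.X j ^ 2 : MvPolynomial ℤ K) ≠ 0 := by
  obtain ⟨j, hj⟩ := hT
  intro h
  have heval := congrArg (MvPolynomial.eval (Pi.single j 1)) h
  simp [Pi.single_apply, hj] at heval

theorem x_ne_zero (k v : ℤ) : x K k v ≠ 0 :=
  (map_ne_zero_iff _ (IsFractionRing.injective _ _)).2 (MvPolynomial.X_ne_zero _)

theorem xMon_ne_zero (S : Multiset ℤ) : xMon K S ≠ 0 := by
  rw [← algebraMap_xPoly, map_ne_zero_iff _ (IsFractionRing.injective _ _)]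
  intro h
  apply prod_map_X_ne_zero K S
  rw [← rename_snd_xPoly, h, map_zero]

theorem raise_XMon_ne_zero (S : Multiset ℤ) : raise K (XMon K S) ≠ 0 :=
  (map_ne_zero _).2 (pow_ne_zero 2 (xMon_ne_zero K S))

end Weights

section ZPolynomials

variable (K : Type*) [Field K]

-- Identifying all `x_{k,v}` with the same `v` turns `∑ X_{S ∪ j}` into `X_S ∑ x_j ^ 2`.
theorem zPoly_ne_zero (S : Multiset ℤ) {T : Finset ℤ} (hT : T.Nonempty) :
    zPoly K S T.val ≠ 0 := by
  have hsum : (T.val.map fun j => XMon K (j ::ₘ S)).sum =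
      algebraMap _ (RatFun K) (∑ j ∈ T, xPoly K (j ::ₘ S) ^ 2) := by
    simp only [map_sum, map_pow, algebraMap_xPoly]
    rfl
  have hrename : MvPolynomial.rename Prod.snd (∑ j ∈ T, xPoly K (j ::ₘ S) ^ 2) =
      (S.map (MvPolynomial.X (R := K))).prod ^ 2 * ∑ j ∈ T, MvPolynomial.X j ^ 2 := by
    simp only [map_sum, map_pow, rename_snd_xPoly, Multiset.map_cons, Multiset.prod_cons,
      mul_pow, mul_sum, mul_comm]
  rw [zPoly, raisePow_one, hsum]
  refine mul_ne_zero (inv_ne_zero (raise_XMon_ne_zero K S))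
    ((map_ne_zero_iff _ (IsFractionRing.injective _ _)).2 fun h => ?_)
  rw [h, map_zero] at hrename
  exact mul_ne_zero (pow_ne_zero 2 (prod_map_X_ne_zero K S)) (sum_X_sq_ne_zero K hT) hrename.symm

theorem zPoly_zero_right (S : Multiset ℤ) : zPoly K S 0 = 0 := by simp [zPoly]

theorem zPoly_cons_right {p : ℤ} {S : Multiset ℤ} (hS : ∀ v ∈ S, p ≤ v) (T : Multiset ℤ) :
    zPoly K S (p ::ₘ T) = x K 1 p ^ 2 + zPoly K S T := by
  rw [zPoly, zPoly, raisePow_one, Multiset.map_cons, Multiset.sum_cons, XMon_cons K hS, mul_add,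
    mul_left_comm, inv_mul_cancel₀ (raise_XMon_ne_zero K S), mul_one]

theorem zPoly_cons_left {p : ℤ} {S T : Multiset ℤ} (hS : ∀ v ∈ S, p ≤ v) (hT : ∀ v ∈ T, p ≤ v) :
    zPoly K (p ::ₘ S) T = x K 1 p ^ 2 / x K 2 p ^ 2 * raise K (zPoly K S T) := by
  have hsum : (T.map fun j => XMon K (j ::ₘ p ::ₘ S)) =
      T.map fun j => x K 1 p ^ 2 * raise K (XMon K (j ::ₘ S)) :=
    Multiset.map_congr rfl fun j hj => by
      rw [Multiset.cons_swap, XMon_cons]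
      exact Multiset.forall_mem_cons.2 ⟨hT j hj, hS⟩
  rw [zPoly, zPoly, raisePow_one, raisePow_one, XMon_cons K hS, map_mul, map_mul, map_pow, raise_x,
    map_inv₀, map_multiset_sum, Multiset.map_map, hsum, Multiset.sum_map_mul_left, mul_inv,
    one_add_one_eq_two, div_eq_mul_inv]
  simp only [Function.comp_def]
  ring

theorem zPoly_cons_cons {p : ℤ} {S T : Multiset ℤ} (hS : ∀ v ∈ S, p ≤ v) (hT : ∀ v ∈ T, p ≤ v) :
    zPoly K (p ::ₘ S) (p ::ₘ T) =
      x K 1 p ^ 2 + x K 1 p ^ 2 / x K 2 p ^ 2 * raise K (zPoly K S T) := by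
  rw [zPoly_cons_right K (Multiset.forall_mem_cons.2 ⟨le_rfl, hS⟩), zPoly_cons_left K hS hT]

end ZPolynomials

section WeightedIncidence

variable (K : Type*) [Field K]

/-- The coefficient of the face `E` in the finely weighted boundary of the face `G`, for a complex
of the dimension of `G`. -/
noncomputable def weightedIncidence (E G : Finset ℤ) : RatFun K :=
  incidence E G * (xMon K G.val / raise K (xMon K E.val))

/-- The matrix of the finely weighted boundary map from chains on `𝓖` to chains on `𝓔`. -/
noncomputable def weightedMatrix (𝓔 𝓖 : Finset (Finset ℤ)) : Matrix 𝓔 𝓖 (RatFun K) :=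
  .of fun E G => weightedIncidence K E G

/-- The finely weighted up-down Laplacian on chains on `𝓔`, with the faces of `𝓖` above them. -/
noncomputable def weightedLaplacian (𝓔 𝓖 : Finset (Finset ℤ)) : Matrix 𝓔 𝓔 (RatFun K) :=
  weightedMatrix K 𝓔 𝓖 * (weightedMatrix K 𝓔 𝓖)ᵀ

variable {p : ℤ} {E F : Finset ℤ}

theorem raise_weightedIncidence_mul (E F G : Finset ℤ) :
    raise K (weightedIncidence K E F) * weightedIncidence K F G =
      (incidence E F * incidence F G : ℤ) *
        (xMon K G.val / raise K (raise K (xMon K E.val))) := by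
  have hF : raise K (xMon K F.val) ≠ 0 := (map_ne_zero _).2 (xMon_ne_zero K _)
  rw [weightedIncidence, weightedIncidence, map_mul, map_intCast, map_div₀, Int.cast_mul]
  field_simp

theorem xMon_insert (hF : ∀ v ∈ F, p < v) :
    xMon K (insert p F).val = x K 1 p * raise K (xMon K F.val) := by
  rw [insert_val_of_notMem fun h => (hF p h).false, xMon_cons]
  exact fun v hv => (hF v hv).le

theorem weightedIncidence_insert_mul (hF : ∀ v ∈ F, p < v) (E G : Finset ℤ) :
    weightedIncidence K E (insert p F) * weightedIncidence K F G =
      (incidence E (insert p F) * incidence F G : ℤ) *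
        (x K 1 p * (xMon K G.val / raise K (xMon K E.val))) := by
  have hF0 : raise K (xMon K F.val) ≠ 0 := (map_ne_zero _).2 (xMon_ne_zero K _)
  rw [weightedIncidence, weightedIncidence, xMon_insert K hF, Int.cast_mul]
  field_simp

theorem weightedIncidence_insert_of_notMem (hE : p ∉ E) (hF : ∀ v ∈ F, p < v) :
    weightedIncidence K E (insert p F) = if E = F then x K 1 p else 0 := by
  rw [weightedIncidence, incidence_insert_of_notMem hE hF, xMon_insert K hF]
  split_ifs with h
  · rw [h, Int.cast_one, one_mul,
      mul_div_cancel_right₀ _ ((map_ne_zero _).2 (xMon_ne_zero K _))]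
  · rw [Int.cast_zero, zero_mul]

theorem weightedIncidence_insert_insert (hE : p ∉ E) (hF : ∀ v ∈ F, p < v) :
    weightedIncidence K (insert p E) (insert p F) =
      -(x K 1 p / x K 2 p) * raise K (weightedIncidence K E F) := by
  rw [weightedIncidence, weightedIncidence, incidence_insert_insert hE hF]
  by_cases hEF : E ⊆ F
  · rw [xMon_insert K hF, xMon_insert K fun v hv => hF v (hEF hv), map_mul, map_mul, raise_x,
      map_div₀, map_intCast, Int.cast_neg, mul_div_mul_comm, one_add_one_eq_two]
    ring
  · simp [incidence_eq_zero_of_not_subset hEF]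

end WeightedIncidence

namespace IsNearCone

variable (K : Type*) [Field K] {p : ℤ} {𝓔 𝓖 : Finset (Finset ℤ)} (h : IsNearCone p 𝓖)
include h

theorem weightedMatrix_map_raise_mul (𝓔 : Finset (Finset ℤ)) :
    (weightedMatrix K 𝓔 (𝓖.memberSubfamily p)).map (raise K) *
      weightedMatrix K (𝓖.memberSubfamily p) (𝓖.nonMemberSubfamily p) = 0 := by
  ext E G
  have hsum := sum_incidence_mul_incidence (fun j hj => h.erase_mem_memberSubfamily G.2 hj) E
  simp only [Matrix.mul_apply, Matrix.map_apply, weightedMatrix, Matrix.of_apply,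
    raise_weightedIncidence_mul, ← sum_mul, ← Int.cast_sum]
  rw [sum_coe_sort _ fun F => incidence E F * incidence F G, hsum, Int.cast_zero, zero_mul,
    Matrix.zero_apply]

theorem weightedLaplacian_mul_map_raise (𝓔 : Finset (Finset ℤ)) :
    weightedLaplacian K (𝓖.memberSubfamily p) (𝓖.nonMemberSubfamily p) *
      ((weightedMatrix K 𝓔 (𝓖.memberSubfamily p))ᵀ *
        weightedMatrix K 𝓔 (𝓖.memberSubfamily p)).map (raise K) = 0 := by
  have hmap : ((weightedMatrix K 𝓔 (𝓖.memberSubfamily p))ᵀ *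
        weightedMatrix K 𝓔 (𝓖.memberSubfamily p)).map (raise K) =
      ((weightedMatrix K 𝓔 (𝓖.memberSubfamily p)).map (raise K))ᵀ *
        (weightedMatrix K 𝓔 (𝓖.memberSubfamily p)).map (raise K) :=
    Matrix.map_mul (f := (raise K : RatFun K →+* RatFun K))
  rw [hmap, weightedLaplacian, Matrix.mul_assoc, ← Matrix.mul_assoc _ᵀ, ← Matrix.transpose_mul,
    h.weightedMatrix_map_raise_mul K, Matrix.transpose_zero, Matrix.zero_mul, Matrix.mul_zero]

theorem weightedMatrix_submatrix_mul (𝓔 : Finset (Finset ℤ)) :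
    (weightedMatrix K 𝓔 𝓖).submatrix id (coneFace p 𝓖) *
      weightedMatrix K (𝓖.memberSubfamily p) 𝓖 = x K 1 p • weightedMatrix K 𝓔 𝓖 := by
  ext E G
  have hsum := h.sum_incidence_insert_mul_incidence E G.2
  simp only [Matrix.mul_apply, Matrix.submatrix_apply, weightedMatrix, Matrix.of_apply, coneFace,
    id_eq, weightedIncidence_insert_mul K (h.lt_of_mem_memberSubfamily (Subtype.prop _)),
    ← sum_mul, ← Int.cast_sum]
  rw [sum_coe_sort _ fun F => incidence E (insert p F) * incidence F G, hsum, Matrix.smul_apply,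
    Matrix.of_apply, smul_eq_mul, weightedIncidence]
  ring

theorem weightedLaplacian_memberSubfamily :
    weightedLaplacian K (𝓖.memberSubfamily p) 𝓖 = Matrix.scalar _ (x K 1 p ^ 2) +
      weightedLaplacian K (𝓖.memberSubfamily p) (𝓖.nonMemberSubfamily p) := by
  ext F F'
  have hinc (E E' : 𝓖.memberSubfamily p) :
      weightedIncidence K E (insert p E') = if E = E' then x K 1 p else 0 := by
    simp only [weightedIncidence_insert_of_notMem K (mem_memberSubfamily.1 E.2).2
      (h.lt_of_mem_memberSubfamily E'.2), Subtype.ext_iff]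
  simp only [weightedLaplacian, Matrix.mul_apply, Matrix.add_apply, Matrix.transpose_apply,
    weightedMatrix, Matrix.of_apply, Matrix.scalar_apply, Matrix.diagonal_apply]
  rw [sum_coe_sort 𝓖 fun G => weightedIncidence K F G * weightedIncidence K F' G,
    sum_coe_sort (𝓖.nonMemberSubfamily p)
      fun G => weightedIncidence K F G * weightedIncidence K F' G,
    ← sum_memberSubfamily_add_sum_nonMemberSubfamily p 𝓖,
    ← sum_coe_sort (𝓖.memberSubfamily p)]
  congr 1
  simp only [hinc, ite_mul, zero_mul, mul_ite, mul_zero, sum_ite_eq', mem_univ, if_true,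
    pow_two, eq_comm (a := F')]

theorem transpose_submatrix_mul_submatrix (h𝓔 : ∂ 𝓖 ⊆ 𝓔) :
    ((weightedMatrix K 𝓔 𝓖).submatrix id (coneFace p 𝓖))ᵀ *
        (weightedMatrix K 𝓔 𝓖).submatrix id (coneFace p 𝓖) =
      Matrix.scalar _ (x K 1 p ^ 2) + (x K 1 p ^ 2 / x K 2 p ^ 2) •
        ((weightedMatrix K (𝓔.memberSubfamily p) (𝓖.memberSubfamily p))ᵀ *
          weightedMatrix K (𝓔.memberSubfamily p) (𝓖.memberSubfamily p)).map (raise K) := by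
  ext F F'
  have hlt (E : 𝓖.memberSubfamily p) := h.lt_of_mem_memberSubfamily E.2
  have hF : (F : Finset ℤ) ∈ 𝓔.nonMemberSubfamily p :=
    mem_nonMemberSubfamily.2 ⟨h𝓔 (memberSubfamily_subset_shadow F.2), (mem_memberSubfamily.1 F.2).2⟩
  simp only [Matrix.mul_apply, Matrix.add_apply, Matrix.transpose_apply, weightedMatrix,
    Matrix.submatrix_apply, coneFace, id_eq, Matrix.of_apply, Matrix.smul_apply, Matrix.map_apply,
    Matrix.scalar_apply, Matrix.diagonal_apply]
  rw [sum_coe_sort 𝓔 fun E =>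
      weightedIncidence K E (insert p F.1) * weightedIncidence K E (insert p F'.1),
    sum_coe_sort (𝓔.memberSubfamily p)
      fun E => weightedIncidence K E F * weightedIncidence K E F',
    ← sum_memberSubfamily_add_sum_nonMemberSubfamily p 𝓔, add_comm, map_sum, smul_sum]
  congr 1
  · have hterm : ∀ E ∈ 𝓔.nonMemberSubfamily p,
        weightedIncidence K E (insert p F.1) * weightedIncidence K E (insert p F'.1) =
          if E = F then (if F = F' then x K 1 p ^ 2 else 0) else 0 := fun E hE => by
      have hE := (mem_nonMemberSubfamily.1 hE).2
      rw [weightedIncidence_insert_of_notMem K hE (hlt F),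
        weightedIncidence_insert_of_notMem K hE (hlt F'), ite_mul, zero_mul, mul_ite, mul_zero,
        pow_two]
      rcases eq_or_ne E F with rfl | hne
      · simp only [if_true, Subtype.ext_iff]
      · rw [if_neg hne, if_neg hne]
    rw [sum_congr rfl hterm, sum_ite_eq', if_pos hF]
  · refine sum_congr rfl fun E hE => ?_
    have hE := (mem_memberSubfamily.1 hE).2
    rw [weightedIncidence_insert_insert K hE (hlt F),
      weightedIncidence_insert_insert K hE (hlt F'), map_mul, smul_eq_mul]
    ring

end IsNearCone

section NearConeSpectrum

variable (K : Type*) [Field K]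

/-- The `z`-polynomial `z(S, T)` of a pair `(S, T)` of finite sets. -/
noncomputable def zPair (P : Finset ℤ × Finset ℤ) : RatFun K := zPoly K P.1.val P.2.val

/-- The pairs indexing the nonzero eigenvalues of a near-cone with apex `p`, given the pairs `A` for
the deletion and `B` for the link of the apex; `k` is the multiplicity of `z(∅, {p})`. -/
def apexRecurrence (p : ℤ) (A B : Multiset (Finset ℤ × Finset ℤ)) (k : ℕ) :
    Multiset (Finset ℤ × Finset ℤ) :=
  A.map (fun P => (P.1, insert p P.2)) + B.map (fun P => (insert p P.1, insert p P.2)) +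
    Multiset.replicate k (∅, {p})

variable {K} {p : ℤ} {A B : Multiset (Finset ℤ × Finset ℤ)} {k : ℕ}

theorem mem_apexRecurrence {Q : Finset ℤ × Finset ℤ} (hQ : Q ∈ apexRecurrence p A B k) :
    (∃ P ∈ A, Q = (P.1, insert p P.2)) ∨ (∃ P ∈ B, Q = (insert p P.1, insert p P.2)) ∨
      Q = (∅, {p}) := by
  simp only [apexRecurrence, Multiset.mem_add, Multiset.mem_map, Multiset.mem_replicate] at hQ
  obtain (⟨P, hP, rfl⟩ | ⟨P, hP, rfl⟩) | ⟨-, rfl⟩ := hQ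
  exacts [.inl ⟨P, hP, rfl⟩, .inr (.inl ⟨P, hP, rfl⟩), .inr (.inr rfl)]

theorem zPair_ne_zero_of_mem_apexRecurrence {Q : Finset ℤ × Finset ℤ}
    (hQ : Q ∈ apexRecurrence p A B k) : zPair K Q ≠ 0 := by
  obtain ⟨P, -, rfl⟩ | ⟨P, -, rfl⟩ | rfl := mem_apexRecurrence hQ
  exacts [zPoly_ne_zero K _ (insert_nonempty p _), zPoly_ne_zero K _ (insert_nonempty p _),
    zPoly_ne_zero K _ (singleton_nonempty p)]

theorem map_zPair_apexRecurrence (hA : ∀ P ∈ A, (∀ s ∈ P.1, p < s) ∧ ∀ t ∈ P.2, p < t)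
    (hB : ∀ P ∈ B, (∀ s ∈ P.1, p < s) ∧ ∀ t ∈ P.2, p < t) (k : ℕ) :
    (apexRecurrence p A B k).map (zPair K) =
      (A.map (zPair K) + ((B.map (zPair K)).map (raise K)).map
        (x K 1 p ^ 2 / x K 2 p ^ 2 * ·)).map (x K 1 p ^ 2 + ·) +
      Multiset.replicate k (x K 1 p ^ 2) := by
  have hval {S : Finset ℤ} (hS : ∀ s ∈ S, p < s) : (insert p S).val = p ::ₘ S.val :=
    insert_val_of_notMem fun h => (hS p h).false
  simp only [apexRecurrence, Multiset.map_add, Multiset.map_map, Multiset.map_replicate,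
    Function.comp_def]
  congr 1
  · congr 1
    · refine Multiset.map_congr rfl fun P hP => ?_
      obtain ⟨hS, hT⟩ := hA P hP
      rw [zPair, hval hT, zPoly_cons_right K fun s hs => (hS s hs).le, zPair]
    · refine Multiset.map_congr rfl fun P hP => ?_
      obtain ⟨hS, hT⟩ := hB P hP
      rw [zPair, hval hS, hval hT,
        zPoly_cons_cons K (fun s hs => (hS s hs).le) fun t ht => (hT t ht).le, zPair]
  · rw [zPair, empty_val, singleton_val, ← Multiset.cons_zero, zPoly_cons_right K (by simp),
      zPoly_zero_right, add_zero]

theorem sq_add_ne_zero_of_mem (hA : ∀ P ∈ A, (∀ s ∈ P.1, p < s) ∧ ∀ t ∈ P.2, p < t)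
    (hB : ∀ P ∈ B, (∀ s ∈ P.1, p < s) ∧ ∀ t ∈ P.2, p < t) {r : RatFun K}
    (hr : r ∈ A.map (zPair K) + ((B.map (zPair K)).map (raise K)).map
      (x K 1 p ^ 2 / x K 2 p ^ 2 * ·)) : x K 1 p ^ 2 + r ≠ 0 := by
  have hmem : x K 1 p ^ 2 + r ∈ (apexRecurrence p A B 0).map (zPair K) := by
    rw [map_zPair_apexRecurrence hA hB 0]
    exact Multiset.mem_add.2 (.inl (Multiset.mem_map_of_mem _ hr))
  obtain ⟨Q, hQ, hQr⟩ := Multiset.mem_map.1 hmem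
  exact hQr ▸ zPair_ne_zero_of_mem_apexRecurrence hQ

theorem IsNearCone.hasNonzeroEigenvalues_apexRecurrence {𝓔 𝓖 : Finset (Finset ℤ)}
    (h : IsNearCone p 𝓖) (h𝓔 : ∂ 𝓖 ⊆ 𝓔)
    (hA : ∀ P ∈ A, (∀ s ∈ P.1, p < s) ∧ ∀ t ∈ P.2, p < t)
    (hB : ∀ P ∈ B, (∀ s ∈ P.1, p < s) ∧ ∀ t ∈ P.2, p < t)
    (hdel : HasNonzeroEigenvalues
      (weightedLaplacian K (𝓖.memberSubfamily p) (𝓖.nonMemberSubfamily p)) (A.map (zPair K)))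
    (hlink : HasNonzeroEigenvalues
      (weightedLaplacian K (𝓔.memberSubfamily p) (𝓖.memberSubfamily p)) (B.map (zPair K))) :
    ∃ k, A.card + B.card + k = #(𝓖.memberSubfamily p) ∧
      HasNonzeroEigenvalues (weightedLaplacian K 𝓔 𝓖)
        ((apexRecurrence p A B k).map (zPair K)) := by
  have hq : x K 1 p ^ 2 / x K 2 p ^ 2 ≠ 0 :=
    div_ne_zero (pow_ne_zero 2 (x_ne_zero K 1 p)) (pow_ne_zero 2 (x_ne_zero K 2 p))
  have hlink' : HasNonzeroEigenvalues _ (((B.map (zPair K)).map (raise K)).map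
      (x K 1 p ^ 2 / x K 2 p ^ 2 * ·)) :=
    (hlink.mul_comm.map (raise K : RatFun K →+* RatFun K)).smul hq
  have hmul := h.weightedLaplacian_mul_map_raise K (𝓔.memberSubfamily p)
  obtain ⟨k, hk, hspec⟩ := hdel.mul_transpose_of_factorization (x_ne_zero K 1 p)
    (h.weightedMatrix_submatrix_mul K 𝓔) (h.transpose_submatrix_mul_submatrix K h𝓔)
    (h.weightedLaplacian_memberSubfamily K) (by rw [Matrix.mul_smul, hmul, smul_zero]) hlink'
    fun r hr => sq_add_ne_zero_of_mem hA hB hr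
  refine ⟨k, by simpa using hk, ?_⟩
  rw [map_zPair_apexRecurrence hA hB k]
  exact hspec

end NearConeSpectrum

section ShiftedFamily

variable {𝓖 : Finset (Finset ℤ)} {a b p : ℤ}

theorem IsNearCone.shadow_nonMemberSubfamily_subset (h : IsNearCone p 𝓖) :
    ∂ (𝓖.nonMemberSubfamily p) ⊆ 𝓖.memberSubfamily p := fun E hE => by
  obtain ⟨G, hG, j, hj, rfl⟩ := mem_shadow_iff.1 hE
  exact h.erase_mem_memberSubfamily hG hj

theorem shadow_memberSubfamily_subset {𝓔 : Finset (Finset ℤ)} (h𝓔 : ∂ 𝓖 ⊆ 𝓔) :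
    ∂ (𝓖.memberSubfamily p) ⊆ 𝓔.memberSubfamily p := fun E hE => by
  obtain ⟨F, hF, j, hj, rfl⟩ := mem_shadow_iff.1 hE
  obtain ⟨hF, hp⟩ := mem_memberSubfamily.1 hF
  have hpj : p ≠ j := fun e => hp (e ▸ hj)
  refine mem_memberSubfamily.2 ⟨h𝓔 ?_, fun h => hp (mem_of_mem_erase h)⟩
  rw [← erase_insert_of_ne hpj]
  exact erase_mem_shadow hF (mem_insert_of_mem hj)

/-- A shifted family of subsets of the interval `[a, b]`; unlike a shifted complex it is not closed
under subsets. -/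
structure IsShiftedFamily (𝓖 : Finset (Finset ℤ)) (a b : ℤ) : Prop where
  subset_interval : ∀ F ∈ 𝓖, F ⊆ Icc a b
  exchange : ∀ F ∈ 𝓖, ∀ i j : ℤ, a ≤ i → i < j → i ∉ F → j ∈ F → insert i (F.erase j) ∈ 𝓖

namespace IsShiftedFamily

variable (h : IsShiftedFamily 𝓖 a b)
include h

theorem isNearCone : IsNearCone a 𝓖 where
  le G hG _ hv := (mem_Icc.1 (h.subset_interval G hG hv)).1
  insert_erase_mem G hG haG j hj :=
    h.exchange G hG a j le_rfl
      ((mem_Icc.1 (h.subset_interval G hG hj)).1.lt_of_ne fun e => haG (e ▸ hj)) haG hj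

theorem lt_of_mem_nonMemberSubfamily {G : Finset ℤ} (hG : G ∈ 𝓖.nonMemberSubfamily a) :
    ∀ v ∈ G, a < v := fun v hv =>
  have hG := mem_nonMemberSubfamily.1 hG
  (h.isNearCone.le G hG.1 v hv).lt_of_ne fun e => hG.2 (e ▸ hv)

protected theorem nonMemberSubfamily : IsShiftedFamily (𝓖.nonMemberSubfamily a) (a + 1) b where
  subset_interval F hF v hv := mem_Icc.2 ⟨h.lt_of_mem_nonMemberSubfamily hF v hv,
    (mem_Icc.1 (h.subset_interval F (mem_nonMemberSubfamily.1 hF).1 hv)).2⟩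
  exchange F hF i j hi hij hiF hj := by
    rw [mem_nonMemberSubfamily] at hF ⊢
    refine ⟨h.exchange F hF.1 i j (by omega) hij hiF hj, ?_⟩
    simp only [mem_insert, mem_erase, not_or, not_and]
    exact ⟨by omega, fun _ => hF.2⟩

protected theorem memberSubfamily : IsShiftedFamily (𝓖.memberSubfamily a) (a + 1) b where
  subset_interval F hF v hv := mem_Icc.2 ⟨h.isNearCone.lt_of_mem_memberSubfamily hF v hv,
    (mem_Icc.1 (h.subset_interval _ (mem_memberSubfamily.1 hF).1 (mem_insert_of_mem hv))).2⟩
  exchange F hF i j hi hij hiF hj := by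
    have haj := h.isNearCone.lt_of_mem_memberSubfamily hF j hj
    rw [mem_memberSubfamily] at hF ⊢
    have hi' : i ∉ insert a F := by
      simp only [mem_insert, not_or]
      exact ⟨by omega, hiF⟩
    have hmem := h.exchange _ hF.1 i j (by omega) hij hi' (mem_insert_of_mem hj)
    rw [erase_insert_of_ne haj.ne, insert_comm] at hmem
    refine ⟨hmem, ?_⟩
    simp only [mem_insert, mem_erase, not_or, not_and]
    exact ⟨by omega, fun _ => hF.2⟩

end IsShiftedFamily

/-- The pairs `A` index the nonzero eigenvalues `z(S, T)` of the weighted Laplacian of a family `𝓖`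
with apex `a`; their number is the rank of the boundary map of `𝓖`. -/
structure IsZSpectrum (K : Type*) [Field K] (𝓖 : Finset (Finset ℤ)) (a : ℤ)
    (A : Multiset (Finset ℤ × Finset ℤ)) : Prop where
  card_eq : A.card = #(𝓖.memberSubfamily a)
  subset_sup : ∀ P ∈ A, P.1 ⊆ 𝓖.sup id ∧ P.2 ⊆ 𝓖.sup id
  hasNonzeroEigenvalues : ∀ 𝓔, ∂ 𝓖 ⊆ 𝓔 →
    HasNonzeroEigenvalues (weightedLaplacian K 𝓔 𝓖) (A.map (zPair K))

variable {K : Type*} [Field K] {A B : Multiset (Finset ℤ × Finset ℤ)}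

theorem IsZSpectrum.lt (hA : IsZSpectrum K 𝓖 a A) (h : ∀ G ∈ 𝓖, ∀ v ∈ G, p < v) :
    ∀ P ∈ A, (∀ s ∈ P.1, p < s) ∧ ∀ t ∈ P.2, p < t := by
  have hsup : ∀ v ∈ 𝓖.sup id, p < v := fun v hv =>
    have ⟨G, hG, hvG⟩ := mem_sup.1 hv
    h G hG v hvG
  exact fun P hP => ⟨fun s hs => hsup s ((hA.subset_sup P hP).1 hs),
    fun t ht => hsup t ((hA.subset_sup P hP).2 ht)⟩

theorem apexRecurrence_subset_sup
    (hA : ∀ P ∈ A, P.1 ⊆ (𝓖.nonMemberSubfamily a).sup id ∧ P.2 ⊆ (𝓖.nonMemberSubfamily a).sup id)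
    (hB : ∀ P ∈ B, P.1 ⊆ (𝓖.memberSubfamily a).sup id ∧ P.2 ⊆ (𝓖.memberSubfamily a).sup id)
    (hne : (𝓖.memberSubfamily a).Nonempty) {k : ℕ} {Q : Finset ℤ × Finset ℤ}
    (hQ : Q ∈ apexRecurrence a A B k) : Q.1 ⊆ 𝓖.sup id ∧ Q.2 ⊆ 𝓖.sup id := by
  have hdel : (𝓖.nonMemberSubfamily a).sup id ⊆ 𝓖.sup id := sup_mono (filter_subset _ _)
  have hlink : (𝓖.memberSubfamily a).sup id ⊆ 𝓖.sup id := Finset.sup_le fun F hF =>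
    (subset_insert a F).trans (le_sup (f := id) (mem_memberSubfamily.1 hF).1)
  have ha : a ∈ 𝓖.sup id := by
    obtain ⟨F, hF⟩ := hne
    exact mem_sup.2 ⟨_, (mem_memberSubfamily.1 hF).1, mem_insert_self a F⟩
  obtain ⟨P, hP, rfl⟩ | ⟨P, hP, rfl⟩ | rfl := mem_apexRecurrence hQ
  · exact ⟨(hA P hP).1.trans hdel, insert_subset ha ((hA P hP).2.trans hdel)⟩
  · exact ⟨insert_subset ha ((hB P hP).1.trans hlink), insert_subset ha ((hB P hP).2.trans hlink)⟩
  · exact ⟨empty_subset _, singleton_subset_iff.2 ha⟩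

namespace IsShiftedFamily

variable (h : IsShiftedFamily 𝓖 a b)
include h

theorem exists_isZSpectrum_apexRecurrence
    (hA : IsZSpectrum K (𝓖.nonMemberSubfamily a) (a + 1) A)
    (hB : IsZSpectrum K (𝓖.memberSubfamily a) (a + 1) B) :
    ∃ k, IsZSpectrum K 𝓖 a (apexRecurrence a A B k) := by
  have hspec (𝓔 : Finset (Finset ℤ)) (h𝓔 : ∂ 𝓖 ⊆ 𝓔) :=
    h.isNearCone.hasNonzeroEigenvalues_apexRecurrence h𝓔
      (hA.lt fun G => h.lt_of_mem_nonMemberSubfamily)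
      (hB.lt fun F => h.isNearCone.lt_of_mem_memberSubfamily)
      (hA.hasNonzeroEigenvalues _ h.isNearCone.shadow_nonMemberSubfamily_subset)
      (hB.hasNonzeroEigenvalues _ (shadow_memberSubfamily_subset h𝓔))
  obtain ⟨k, hk, -⟩ := hspec _ subset_rfl
  have hcard : (apexRecurrence a A B k).card = #(𝓖.memberSubfamily a) := by
    simp only [apexRecurrence, Multiset.card_add, Multiset.card_map, Multiset.card_replicate, hk]
  refine ⟨k, hcard, fun Q hQ => apexRecurrence_subset_sup hA.subset_sup hB.subset_sup ?_ hQ,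
    fun 𝓔 h𝓔 => ?_⟩
  · exact card_pos.1 (hcard ▸ Multiset.card_pos_iff_exists_mem.2 ⟨Q, hQ⟩)
  · obtain ⟨k', hk', hspec'⟩ := hspec 𝓔 h𝓔
    rwa [show k = k' by omega]

theorem exists_isZSpectrum (K : Type*) [Field K] : ∃ A, IsZSpectrum K 𝓖 a A := by
  induction hN : (b + 1 - a).toNat generalizing a 𝓖 with
  | zero =>
    have hempty : ∀ G ∈ 𝓖, G = ∅ := fun G hG => by
      rw [← subset_empty, ← Icc_eq_empty (show ¬ a ≤ b by omega)]
      exact h.subset_interval G hG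
    refine ⟨0, ?_, by simp, fun 𝓔 _ => ?_⟩
    · rw [Multiset.card_zero, eq_comm, card_eq_zero, eq_empty_iff_forall_notMem]
      exact fun F hF => insert_ne_empty a F (hempty _ (mem_memberSubfamily.1 hF).1)
    · have hzero : weightedMatrix K 𝓔 𝓖 = 0 := by
        ext E G
        simp [weightedMatrix, weightedIncidence, incidence, hempty _ G.2]
      rw [weightedLaplacian, hzero, Matrix.zero_mul]
      exact HasNonzeroEigenvalues.zero
  | succ N ih =>
    obtain ⟨A, hA⟩ := ih h.nonMemberSubfamily (by omega)
    obtain ⟨B, hB⟩ := ih h.memberSubfamily (by omega)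
    obtain ⟨k, hk⟩ := h.exists_isZSpectrum_apexRecurrence hA hB
    exact ⟨_, hk⟩

end IsShiftedFamily

end ShiftedFamily

section Complexes

variable {C : Finset (Finset ℤ)} {a b i p : ℤ} {F : Finset ℤ}

theorem mem_facesOfDim : F ∈ facesOfDim C i ↔ F ∈ C ∧ (#F : ℤ) = i + 1 := mem_filter

theorem facesOfDim_subset (C : Finset (Finset ℤ)) (i : ℤ) : facesOfDim C i ⊆ C :=
  filter_subset _ C

theorem mem_pureSkeleton : F ∈ pureSkeleton C i ↔ F ∈ C ∧ ∃ G ∈ facesOfDim C i, F ⊆ G :=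
  mem_filter

theorem facesOfDim_pureSkeleton : facesOfDim (pureSkeleton C i) i = facesOfDim C i := by
  ext F
  rw [mem_facesOfDim, mem_pureSkeleton, and_assoc, mem_facesOfDim]
  exact ⟨fun h => ⟨h.1, h.2.2⟩, fun h => ⟨h.1, ⟨F, mem_facesOfDim.2 h, subset_rfl⟩, h.2⟩⟩

theorem card_le_of_mem_pureSkeleton (hF : F ∈ pureSkeleton C i) : (#F : ℤ) ≤ i + 1 := by
  obtain ⟨-, G, hG, hFG⟩ := mem_pureSkeleton.1 hF
  rw [← (mem_facesOfDim.1 hG).2]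
  exact_mod_cast card_le_card hFG

theorem exists_nonempty_mem_pureSkeleton (h0 : 0 ≤ i) (h : (facesOfDim C i).Nonempty) :
    ∃ F ∈ pureSkeleton C i, F.Nonempty := by
  obtain ⟨G, hG⟩ := h
  have hcard := (mem_facesOfDim.1 hG).2
  exact ⟨G, mem_pureSkeleton.2 ⟨facesOfDim_subset C i hG, G, hG, subset_rfl⟩,
    card_pos.1 (by omega)⟩

theorem facesOfDim_nonMemberSubfamily :
    facesOfDim (C.nonMemberSubfamily p) i = (facesOfDim C i).nonMemberSubfamily p :=
  filter_comm _ _ C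

theorem facesOfDim_memberSubfamily :
    facesOfDim (C.memberSubfamily p) (i - 1) = (facesOfDim C i).memberSubfamily p := by
  ext F
  rw [mem_facesOfDim, mem_memberSubfamily, mem_memberSubfamily, mem_facesOfDim, and_right_comm,
    and_congr_left_iff]
  intro hp
  rw [card_insert_of_notMem hp, Nat.cast_succ, sub_add_cancel, add_left_inj]

theorem dimension_eq (h : (facesOfDim C i).Nonempty) (hle : ∀ F ∈ C, (#F : ℤ) ≤ i + 1) :
    dimension C = i := by
  obtain ⟨F, hF⟩ := h
  rw [mem_facesOfDim] at hF
  have hge : #F ≤ C.sup card := le_sup hF.1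
  have hsup : C.sup card ≤ #F := Finset.sup_le fun G hG => by
    have := hle G hG
    omega
  rw [dimension]
  omega

namespace IsShiftedFamily

variable (h : IsShiftedFamily C a b)
include h

protected theorem facesOfDim (i : ℤ) : IsShiftedFamily (facesOfDim C i) a b where
  subset_interval F hF := h.subset_interval F (facesOfDim_subset C i hF)
  exchange F hF k j hk hkj hkF hj := by
    rw [mem_facesOfDim] at hF ⊢
    refine ⟨h.exchange F hF.1 k j hk hkj hkF hj, ?_⟩
    rw [card_insert_of_notMem fun h => hkF (mem_of_mem_erase h), card_erase_add_one hj, hF.2]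

protected theorem pureSkeleton (i : ℤ) : IsShiftedFamily (pureSkeleton C i) a b where
  subset_interval F hF := h.subset_interval F (mem_pureSkeleton.1 hF).1
  exchange F hF k j hk hkj hkF hj := by
    obtain ⟨hFC, G, hG, hFG⟩ := mem_pureSkeleton.1 hF
    refine mem_pureSkeleton.2 ⟨h.exchange F hFC k j hk hkj hkF hj, ?_⟩
    by_cases hkG : k ∈ G
    · exact ⟨G, hG, insert_subset hkG ((erase_subset j F).trans hFG)⟩
    · exact ⟨_, (h.facesOfDim i).exchange G hG k j hk hkj hkG (hFG hj),
        insert_subset_insert k (erase_subset_erase j hFG)⟩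

end IsShiftedFamily

namespace IsSimplicialComplex

variable (hC : IsSimplicialComplex C)
include hC

theorem shadow_facesOfDim_subset (i : ℤ) : ∂ (facesOfDim C i) ⊆ facesOfDim C (i - 1) := by
  intro E hE
  obtain ⟨G, hG, j, hj, rfl⟩ := mem_shadow_iff.1 hE
  rw [mem_facesOfDim] at hG ⊢
  refine ⟨hC.down_closed G hG.1 _ (erase_subset j G), ?_⟩
  have := card_erase_add_one hj
  omega

theorem coe_subset_vertices {S : Finset ℤ} (hS : S ⊆ C.sup id) : (S : Set ℤ) ⊆ vertices C := by
  intro v hv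
  obtain ⟨F, hF, hvF⟩ := mem_sup.1 (hS hv)
  exact hC.down_closed F hF _ (singleton_subset_iff.2 hvF)

theorem facesOfDim_nonempty (h0 : 0 ≤ i) (hi : i ≤ dimension C) : (facesOfDim C i).Nonempty := by
  obtain ⟨F, hF, hFcard⟩ := exists_mem_eq_sup C ⟨∅, hC.empty_mem⟩ card
  rw [dimension, hFcard] at hi
  obtain ⟨G, hGF, hG⟩ := exists_subset_card_eq (show (i + 1).toNat ≤ #F by omega)
  exact ⟨G, mem_facesOfDim.2 ⟨hC.down_closed F hF G hGF, by omega⟩⟩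

protected theorem pureSkeleton (h : (facesOfDim C i).Nonempty) :
    IsSimplicialComplex (pureSkeleton C i) where
  empty_mem := by
    obtain ⟨G, hG⟩ := h
    exact mem_pureSkeleton.2 ⟨hC.empty_mem, G, hG, empty_subset G⟩
  down_closed F hF G hGF := by
    obtain ⟨hFC, H, hH, hFH⟩ := mem_pureSkeleton.1 hF
    exact mem_pureSkeleton.2 ⟨hC.down_closed F hFC G hGF, H, hH, hGF.trans hFH⟩

theorem deletion_eq_nonMemberSubfamily (p : ℤ) : deletion C p = C.nonMemberSubfamily p := by
  ext F
  rw [deletion, mem_image, mem_nonMemberSubfamily]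
  constructor
  · rintro ⟨G, hG, rfl⟩
    exact ⟨hC.down_closed G hG _ (erase_subset p G), notMem_erase p G⟩
  · rintro ⟨hF, hp⟩
    exact ⟨F, hF, erase_eq_of_notMem hp⟩

theorem link_eq_memberSubfamily (p : ℤ) : link C p = C.memberSubfamily p := by
  ext F
  rw [link, mem_filter, mem_memberSubfamily, and_comm (a := p ∉ F),
    and_iff_right_iff_imp]
  exact fun h => hC.down_closed _ h.1 F (subset_insert p F)

protected theorem deletion (p : ℤ) : IsSimplicialComplex (deletion C p) := by
  rw [hC.deletion_eq_nonMemberSubfamily]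
  refine ⟨mem_nonMemberSubfamily.2 ⟨hC.empty_mem, notMem_empty p⟩, fun F hF G hGF => ?_⟩
  rw [mem_nonMemberSubfamily] at hF ⊢
  exact ⟨hC.down_closed F hF.1 G hGF, fun h => hF.2 (hGF h)⟩

protected theorem link (hp : p ∈ vertices C) : IsSimplicialComplex (link C p) := by
  rw [hC.link_eq_memberSubfamily]
  refine ⟨mem_memberSubfamily.2 ⟨hp, notMem_empty p⟩, fun F hF G hGF => ?_⟩
  rw [mem_memberSubfamily] at hF ⊢
  exact ⟨hC.down_closed _ hF.1 _ (insert_subset_insert p hGF), fun h => hF.2 (hGF h)⟩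

theorem boundary_mul_boundary (i : ℤ) : boundary C i * boundary C (i + 1) = 0 := by
  ext E G
  have hsum := sum_incidence_mul_incidence (𝓕 := facesOfDim C (i + 1)) (fun j hj => by
    have hmem := hC.shadow_facesOfDim_subset (i + 1 + 1) (erase_mem_shadow G.2 hj)
    rwa [add_sub_cancel_right] at hmem) E
  rwa [← sum_coe_sort] at hsum

theorem bettiSucc_add_rank_add_rank (i : ℤ) :
    bettiSucc C i + (boundary C (i + 1)).rank + (boundary C i).rank = #(facesOfDim C (i + 1)) := by
  have hle : LinearMap.range (boundary C (i + 1)).mulVecLin ≤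
      LinearMap.ker (boundary C i).mulVecLin := by
    rw [LinearMap.range_le_ker_iff, ← Matrix.mulVecLin_mul, hC.boundary_mul_boundary,
      Matrix.mulVecLin_zero]
  have hker := Submodule.finrank_quotient_add_finrank
    ((LinearMap.range (boundary C (i + 1)).mulVecLin).submoduleOf
      (LinearMap.ker (boundary C i).mulVecLin))
  rw [(Submodule.submoduleOfEquivOfLe hle).finrank_eq] at hker
  have hrange := Submodule.finrank_quotient_add_finrank (LinearMap.ker (boundary C i).mulVecLin)
  rw [(boundary C i).mulVecLin.quotKerEquivRange.finrank_eq, Module.finrank_fintype_fun_eq_card,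
    Fintype.card_coe] at hrange
  rw [bettiSucc, Matrix.rank, Matrix.rank, hker, add_comm, hrange]

theorem rank_boundary (h : IsNearCone p (facesOfDim C (i + 1))) :
    (boundary C i).rank = #((facesOfDim C (i + 1)).memberSubfamily p) := by
  refine h.rank_incidenceMatrix ?_
  have hshadow := hC.shadow_facesOfDim_subset (i + 1)
  rwa [add_sub_cancel_right] at hshadow

end IsSimplicialComplex

namespace IsShiftedComplex

variable (hC : IsShiftedComplex C a b)
include hC

theorem isShiftedFamily : IsShiftedFamily C a b := ⟨hC.subset_interval, hC.exchange⟩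

theorem isLeast_vertices (hcard : ∃ F ∈ C, F.Nonempty) : IsLeast (vertices C) a := by
  refine ⟨?_, fun v hv => hC.isShiftedFamily.isNearCone.le _ hv v (mem_singleton_self v)⟩
  obtain ⟨F, hF, j, hj⟩ := hcard
  have hjC : {j} ∈ C := hC.down_closed F hF _ (singleton_subset_iff.2 hj)
  rcases eq_or_ne a j with rfl | haj
  · exact hjC
  · have hmem := hC.isShiftedFamily.isNearCone.insert_erase_mem {j} hjC
      (notMem_singleton.2 haj) j (mem_singleton_self j)
    rwa [erase_singleton] at hmem

protected theorem pureSkeleton (h : (facesOfDim C i).Nonempty) :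
    IsShiftedComplex (pureSkeleton C i) a b :=
  have hS := hC.isShiftedFamily.pureSkeleton i
  ⟨hC.toIsSimplicialComplex.pureSkeleton h, hS.subset_interval, hS.exchange⟩

protected theorem deletion : IsShiftedComplex (deletion C a) (a + 1) b :=
  have hD := hC.isShiftedFamily.nonMemberSubfamily
  have heq := hC.deletion_eq_nonMemberSubfamily a
  ⟨hC.toIsSimplicialComplex.deletion a, heq ▸ hD.subset_interval, heq ▸ hD.exchange⟩

protected theorem link (ha : a ∈ vertices C) : IsShiftedComplex (link C a) (a + 1) b :=
  have hL := hC.isShiftedFamily.memberSubfamily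
  have heq := hC.link_eq_memberSubfamily a
  ⟨hC.toIsSimplicialComplex.link ha, heq ▸ hL.subset_interval, heq ▸ hL.exchange⟩

theorem bettiSucc_add_card_add_card (i : ℤ) :
    bettiSucc C i + #((facesOfDim C (i + 1 + 1)).memberSubfamily a) +
      #((facesOfDim C (i + 1)).memberSubfamily a) = #(facesOfDim C (i + 1)) := by
  have hcone (j : ℤ) := (hC.isShiftedFamily.facesOfDim j).isNearCone
  rw [← hC.rank_boundary (hcone _), ← hC.rank_boundary (hcone _), hC.bettiSucc_add_rank_add_rank]

end IsShiftedComplex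

theorem IsNearCone.facesOfDim_deletion_eq_facesOfDim_link (h : IsNearCone p (facesOfDim C i))
    (hC : IsSimplicialComplex C) (hpure : ∀ F ∈ C, ∃ G ∈ facesOfDim C i, F ⊆ G) :
    facesOfDim (deletion C p) (i - 1) = facesOfDim (link C p) (i - 1) := by
  ext E
  rw [hC.deletion_eq_nonMemberSubfamily, hC.link_eq_memberSubfamily, mem_facesOfDim,
    mem_facesOfDim, mem_nonMemberSubfamily, mem_memberSubfamily, and_congr_left_iff,
    and_congr_left_iff]
  intro hcard hp
  refine ⟨fun hE => ?_, fun hE => hC.down_closed _ hE E (subset_insert p E)⟩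
  obtain ⟨G, hG, hEG⟩ := hpure E hE
  have hcov : E ⋖ G := covBy_iff_card_sdiff_eq_one.2 ⟨hEG, by
    have := (mem_facesOfDim.1 hG).2
    rw [card_sdiff_of_subset hEG]
    omega⟩
  obtain ⟨j, hjE, rfl⟩ := covBy_iff_exists_insert.1 hcov
  refine facesOfDim_subset C i ?_
  rcases eq_or_ne j p with rfl | hjp
  · exact hG
  · have hmem := h.insert_erase_mem _ hG (by simp [hjp.symm, hp]) j (mem_insert_self j E)
    rwa [erase_insert hjE] at hmem

end Complexes

theorem sum_sdiff_insert_eq_sum_erase {α M : Type*} [DecidableEq α] [AddCommMonoid M]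
    (E G : Finset α) (f : α → M) :
    (∑ j ∈ G \ E, if insert j E = G then f j else 0) =
      ∑ j ∈ G, if G.erase j = E then f j else 0 := by
  rw [← sum_filter, ← sum_filter]
  refine sum_congr ?_ fun _ _ => rfl
  ext j
  simp only [mem_filter, mem_sdiff]
  constructor
  · rintro ⟨⟨hj, hjE⟩, rfl⟩
    exact ⟨hj, erase_insert hjE⟩
  · rintro ⟨hj, rfl⟩
    exact ⟨⟨hj, notMem_erase j G⟩, insert_erase hj⟩

section Spectrum

variable (K : Type*) [Field K] {C : Finset (Finset ℤ)} {a b i : ℤ}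

theorem raisePow_weightedIncidence (m : ℤ) (E G : Finset ℤ) :
    raisePow K m (weightedIncidence K E G) = ∑ j ∈ G, if G.erase j = E then
      (sgn j G : RatFun K) * (raisePow K m (xMon K G.val) / raisePow K (m + 1) (xMon K E.val))
      else 0 := by
  rw [raisePow_add_one, weightedIncidence, incidence, Int.cast_sum, sum_mul]
  simp only [raisePow, map_sum]
  refine sum_congr rfl fun j _ => ?_
  split_ifs
  · rw [map_mul, map_div₀, map_intCast]
  · rw [Int.cast_zero, zero_mul, map_zero]

theorem algBoundary_eq (C : Finset (Finset ℤ)) (i : ℤ) :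
    algBoundary K C i = (weightedMatrix K (facesOfDim C i) (facesOfDim C (i + 1))).map
      (raisePow K (dimension C - (i + 1))) := by
  ext E G
  rw [Matrix.map_apply, weightedMatrix, Matrix.of_apply, raisePow_weightedIncidence, algBoundary]
  exact sum_congr rfl fun j _ => if_ctx_congr Iff.rfl (fun h => by rw [h]) fun _ => rfl

theorem algCoboundary_eq_transpose (C : Finset (Finset ℤ)) (i : ℤ) :
    algCoboundary K C i = (algBoundary K C i)ᵀ := by
  ext G E
  rw [algBoundary_eq, Matrix.transpose_apply, Matrix.map_apply, weightedMatrix, Matrix.of_apply,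
    raisePow_weightedIncidence, ← sum_sdiff_insert_eq_sum_erase, algCoboundary, sub_add_eq_sub_sub,
    sub_add_cancel]

theorem upDownLaplacian_eq (C : Finset (Finset ℤ)) (i : ℤ) :
    upDownLaplacian K C i = (weightedLaplacian K (facesOfDim C i) (facesOfDim C (i + 1))).map
      (raisePow K (dimension C - (i + 1))) := by
  have hmul := Matrix.map_mul (L := weightedMatrix K (facesOfDim C i) (facesOfDim C (i + 1)))
    (M := (weightedMatrix K (facesOfDim C i) (facesOfDim C (i + 1)))ᵀ)
    (f := (raise K ^ (dimension C - (i + 1)) : RingAut (RatFun K)).toRingHom)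
  rw [upDownLaplacian, algCoboundary_eq_transpose, algBoundary_eq]
  exact hmul.symm

variable {K}

theorem nonzeroPart_upDownSpectrum {R : Multiset (RatFun K)}
    (h : HasNonzeroEigenvalues (weightedLaplacian K (facesOfDim C (i - 1)) (facesOfDim C i)) R) :
    nonzeroPart (upDownSpectrum K C (i - 1)) =
      R.map fun r => emb K (raisePow K (dimension C - i) r) := by
  obtain ⟨j, rfl⟩ : ∃ j, i = j + 1 := ⟨i - 1, (sub_add_cancel i 1).symm⟩
  rw [add_sub_cancel_right] at h ⊢
  have hraise := h.map (raise K ^ (dimension C - (j + 1)) : RingAut (RatFun K)).toRingHom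
  rw [upDownSpectrum, upDownLaplacian_eq]
  exact hraise.nonzeroPart_aroots.trans (Multiset.map_map _ _ _)

variable (K)

theorem emb_injective : Function.Injective (emb K) :=
  FaithfulSMul.algebraMap_injective (RatFun K) (AlgebraicClosure (RatFun K))

namespace IsShiftedComplex

variable (hC : IsShiftedComplex C a b)
include hC

theorem exists_isZSpectrum (i : ℤ) : ∃ A, IsZSpectrum K (facesOfDim C i) a A :=
  (hC.isShiftedFamily.facesOfDim i).exists_isZSpectrum K

theorem subset_vertices_of_isZSpectrum {A : Multiset (Finset ℤ × Finset ℤ)}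
    (hA : IsZSpectrum K (facesOfDim C i) a A) :
    ∀ P ∈ A, (P.1 : Set ℤ) ⊆ vertices C ∧ (P.2 : Set ℤ) ⊆ vertices C := fun P hP =>
  have hsup : (facesOfDim C i).sup id ⊆ C.sup id := sup_mono (facesOfDim_subset C i)
  have hP := hA.subset_sup P hP
  ⟨hC.coe_subset_vertices (hP.1.trans hsup), hC.coe_subset_vertices (hP.2.trans hsup)⟩

theorem exists_zPair_upDownSpectrum (i : ℤ) :
    ∃ A : Multiset (Finset ℤ × Finset ℤ),
      (∀ P ∈ A, (P.1 : Set ℤ) ⊆ vertices C ∧ (P.2 : Set ℤ) ⊆ vertices C) ∧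
      nonzeroPart (upDownSpectrum K C (i - 1)) =
        A.map fun P => emb K (raisePow K (dimension C - i) (zPair K P)) := by
  obtain ⟨A, hA⟩ := hC.exists_isZSpectrum K i
  have hspec := hA.hasNonzeroEigenvalues _ (hC.shadow_facesOfDim_subset i)
  exact ⟨A, hC.subset_vertices_of_isZSpectrum K hA,
    (nonzeroPart_upDownSpectrum hspec).trans (Multiset.map_map _ _ _)⟩

theorem exists_zPoly_of_mem_upDownSpectrum {r : AlgebraicClosure (RatFun K)}
    (hr : r ∈ upDownSpectrum K C (i - 1)) (hr0 : r ≠ 0) :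
    ∃ S T : Finset ℤ, (S : Set ℤ) ⊆ vertices C ∧ (T : Set ℤ) ⊆ vertices C ∧
      r = emb K (raisePow K (dimension C - i) (zPoly K S.val T.val)) := by
  classical
  obtain ⟨A, hA, hspec⟩ := hC.exists_zPair_upDownSpectrum K i
  have hr' : r ∈ nonzeroPart (upDownSpectrum K C (i - 1)) := Multiset.mem_filter.2 ⟨hr, hr0⟩
  rw [hspec] at hr'
  obtain ⟨P, hP, rfl⟩ := Multiset.mem_map.1 hr'
  exact ⟨P.1, P.2, (hA P hP).1, (hA P hP).2, rfl⟩

theorem eq_zero_of_mem_upDownSpectrum (hv : vertices C = ∅) {r : AlgebraicClosure (RatFun K)}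
    (hr : r ∈ upDownSpectrum K C (i - 1)) : r = 0 := by
  by_contra hr0
  obtain ⟨S, T, -, hT, rfl⟩ := hC.exists_zPoly_of_mem_upDownSpectrum K hr hr0
  rw [hv, Set.subset_empty_iff, coe_eq_empty] at hT
  rw [hT, empty_val, zPoly_zero_right, raisePow, map_zero, emb, map_zero] at hr0
  exact hr0 rfl

section NoLargerFaces

variable (hle : ∀ F ∈ C, (#F : ℤ) ≤ i + 1)
include hle

theorem nonzeroPart_upDownSpectrum_eq_map {A : Multiset (Finset ℤ × Finset ℤ)}
    (hA : IsZSpectrum K (facesOfDim C i) a A) :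
    nonzeroPart (upDownSpectrum K C (i - 1)) = (A.map (zPair K)).map (emb K) := by
  rw [nonzeroPart_upDownSpectrum
    (hA.hasNonzeroEigenvalues _ (hC.shadow_facesOfDim_subset i))]
  rcases (facesOfDim C i).eq_empty_or_nonempty with hempty | hne
  · have hcard := hA.card_eq
    rw [hempty, memberSubfamily, filter_empty, image_empty, card_empty, Multiset.card_eq_zero]
      at hcard
    rw [hcard, Multiset.map_zero, Multiset.map_zero, Multiset.map_zero]
  · rw [dimension_eq hne hle, sub_self]
    simp only [raisePow_zero]

theorem exists_map_zPoly_eq_nonzeroPart :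
    ∃ A : Multiset (Finset ℤ × Finset ℤ),
      (∀ P ∈ A, (P.1 : Set ℤ) ⊆ vertices C ∧ (P.2 : Set ℤ) ⊆ vertices C) ∧
      A.map (fun P => emb K (zPoly K P.1.val P.2.val)) =
        nonzeroPart (upDownSpectrum K C (i - 1)) := by
  obtain ⟨A, hA⟩ := hC.exists_isZSpectrum K i
  refine ⟨A, hC.subset_vertices_of_isZSpectrum K hA, ?_⟩
  rw [hC.nonzeroPart_upDownSpectrum_eq_map K hle hA]
  exact (Multiset.map_map _ _ _).symm

theorem hasNonzeroEigenvalues_of_map_eq {A : Multiset (Finset ℤ × Finset ℤ)}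
    (hA : A.map (fun P => emb K (zPoly K P.1.val P.2.val)) =
      nonzeroPart (upDownSpectrum K C (i - 1))) :
    A.card = #((facesOfDim C i).memberSubfamily a) ∧ ∀ 𝓔, ∂ (facesOfDim C i) ⊆ 𝓔 →
      HasNonzeroEigenvalues (weightedLaplacian K 𝓔 (facesOfDim C i)) (A.map (zPair K)) := by
  obtain ⟨A₀, hA₀⟩ := hC.exists_isZSpectrum K i
  have hmap : A.map (zPair K) = A₀.map (zPair K) := by
    apply Multiset.map_injective (emb_injective K)
    rw [← hC.nonzeroPart_upDownSpectrum_eq_map K hle hA₀, ← hA]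
    exact Multiset.map_map _ _ _
  refine ⟨?_, hmap ▸ hA₀.hasNonzeroEigenvalues⟩
  rw [← hA₀.card_eq, ← Multiset.card_map (zPair K), hmap, Multiset.card_map]

end NoLargerFaces

end IsShiftedComplex

end Spectrum

section Recurrence

variable {C : Finset (Finset ℤ)} {a b i : ℤ}

theorem eqUpToZero_of_nonzeroPart_eq {α : Type*} [Zero α] {M N : Multiset α}
    (h : nonzeroPart M = N) : EqUpToZero M N := by
  subst h
  exact (nonzeroPart_eq_self.2 (zero_notMem_nonzeroPart M)).symm

namespace IsSimplicialComplex

variable {p : ℤ} (hC : IsSimplicialComplex C)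
include hC

theorem facesOfDim_deletion (p i : ℤ) :
    facesOfDim (deletion C p) i = (facesOfDim C i).nonMemberSubfamily p := by
  rw [hC.deletion_eq_nonMemberSubfamily, facesOfDim_nonMemberSubfamily]

theorem facesOfDim_link (p i : ℤ) :
    facesOfDim (link C p) (i - 1) = (facesOfDim C i).memberSubfamily p := by
  rw [hC.link_eq_memberSubfamily, facesOfDim_memberSubfamily]

theorem card_le_of_mem_deletion (hle : ∀ F ∈ C, (#F : ℤ) ≤ i + 1) :
    ∀ F ∈ deletion C p, (#F : ℤ) ≤ i + 1 := fun F hF => by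
  rw [hC.deletion_eq_nonMemberSubfamily] at hF
  exact hle F (mem_nonMemberSubfamily.1 hF).1

theorem card_le_of_mem_link (hle : ∀ F ∈ C, (#F : ℤ) ≤ i + 1) :
    ∀ F ∈ link C p, (#F : ℤ) ≤ i - 1 + 1 := fun F hF => by
  rw [hC.link_eq_memberSubfamily, mem_memberSubfamily] at hF
  have hcard := hle _ hF.1
  rw [card_insert_of_notMem hF.2] at hcard
  omega

end IsSimplicialComplex

namespace IsShiftedComplex

variable (hC : IsShiftedComplex C a b)
include hC

theorem bettiSucc_deletion_add_card_add_card (hpure : ∀ F ∈ C, ∃ G ∈ facesOfDim C i, F ⊆ G) :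
    bettiSucc (deletion C a) (i - 2) +
        #((facesOfDim (deletion C a) i).memberSubfamily (a + 1)) +
        #((facesOfDim (link C a) (i - 1)).memberSubfamily (a + 1)) =
      #((facesOfDim C i).memberSubfamily a) := by
  have heq := (hC.isShiftedFamily.facesOfDim i).isNearCone.facesOfDim_deletion_eq_facesOfDim_link
    hC.toIsSimplicialComplex hpure
  have hbetti := hC.deletion.bettiSucc_add_card_add_card (i - 2)
  rw [show i - 2 + 1 = i - 1 by ring, sub_add_cancel, heq] at hbetti
  rw [hbetti, hC.facesOfDim_link]

theorem nonzeroPart_upDownSpectrum_eq_apexRecurrence (K : Type*) [Field K]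
    (hi : (facesOfDim C i).Nonempty) (ha : a ∈ vertices (pureSkeleton C i))
    {A B : Multiset (Finset ℤ × Finset ℤ)}
    (hA : ∀ P ∈ A, (∀ s ∈ P.1, a < s) ∧ ∀ t ∈ P.2, a < t)
    (hB : ∀ P ∈ B, (∀ s ∈ P.1, a < s) ∧ ∀ t ∈ P.2, a < t)
    (hdel : A.map (fun P => emb K (zPoly K P.1.val P.2.val)) = nonzeroPart
      (upDownSpectrum K (deletion (pureSkeleton C i) a) (i - 1)))
    (hlink : B.map (fun P => emb K (zPoly K P.1.val P.2.val)) = nonzeroPart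
      (upDownSpectrum K (link (pureSkeleton C i) a) (i - 2))) :
    nonzeroPart (upDownSpectrum K C (i - 1)) =
      (apexRecurrence a A B
        (bettiSucc (deletion (pureSkeleton C i) a) (i - 2))).map
        fun P => emb K (raisePow K (dimension C - i) (zPair K P)) := by
  have hS := hC.pureSkeleton hi
  have hle : ∀ F ∈ pureSkeleton C i, (#F : ℤ) ≤ i + 1 :=
    fun _ => card_le_of_mem_pureSkeleton
  have hpure : ∀ F ∈ pureSkeleton C i,
      ∃ G ∈ facesOfDim (pureSkeleton C i) i, F ⊆ G := fun F hF => by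
    rw [facesOfDim_pureSkeleton]
    exact (mem_pureSkeleton.1 hF).2
  have hcone := (hC.isShiftedFamily.facesOfDim i).isNearCone
  have h𝓔 := hC.shadow_facesOfDim_subset i
  obtain ⟨hAcard, hAspec⟩ :=
    hS.deletion.hasNonzeroEigenvalues_of_map_eq K (hS.card_le_of_mem_deletion hle) hdel
  rw [show i - 2 = i - 1 - 1 by ring] at hlink
  obtain ⟨hBcard, hBspec⟩ :=
    (hS.link ha).hasNonzeroEigenvalues_of_map_eq K (hS.card_le_of_mem_link hle) hlink
  have hbetti := hS.bettiSucc_deletion_add_card_add_card hpure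
  rw [← hAcard, ← hBcard, facesOfDim_pureSkeleton] at hbetti
  rw [hS.facesOfDim_deletion, facesOfDim_pureSkeleton] at hAspec
  rw [hS.facesOfDim_link, facesOfDim_pureSkeleton] at hBspec
  obtain ⟨k, hk, hspec⟩ := hcone.hasNonzeroEigenvalues_apexRecurrence h𝓔 hA hB
    (hAspec _ hcone.shadow_nonMemberSubfamily_subset)
    (hBspec _ (shadow_memberSubfamily_subset h𝓔))
  obtain rfl : bettiSucc (deletion (pureSkeleton C i) a) (i - 2) = k := by
    omega
  exact (nonzeroPart_upDownSpectrum hspec).trans (Multiset.map_map _ _ _)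

end IsShiftedComplex

end Recurrence

end FineShifted

theorem theorem7p2_general (K : Type*) [Field K] (C : Finset (Finset ℤ)) (a b : ℤ)
    (hC : IsShiftedComplex C a b) :
    (∀ i : ℤ, ∀ r ∈ upDownSpectrum K C (i - 1), r ≠ 0 →
      ∃ S T : Finset ℤ, (S : Set ℤ) ⊆ vertices C ∧ (T : Set ℤ) ⊆ vertices C ∧
        r = emb K (raisePow K (dimension C - i) (zPoly K S.val T.val))) ∧
    (vertices C = ∅ → ∀ i : ℤ, ∀ r ∈ upDownSpectrum K C (i - 1), r = 0) ∧
    (∀ i : ℤ, 0 ≤ i → i ≤ dimension C →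
      ∃ p : ℤ, IsLeast (vertices (pureSkeleton C i)) p ∧
        (∃ A : Multiset (Finset ℤ × Finset ℤ),
          (∀ P ∈ A, (P.1 : Set ℤ) ⊆ vertices (deletion (pureSkeleton C i) p) ∧
            (P.2 : Set ℤ) ⊆ vertices (deletion (pureSkeleton C i) p)) ∧
          A.map (fun P => emb K (zPoly K P.1.val P.2.val)) =
            nonzeroPart (upDownSpectrum K (deletion (pureSkeleton C i) p) (i - 1))) ∧
        (∃ B : Multiset (Finset ℤ × Finset ℤ),
          (∀ P ∈ B, (P.1 : Set ℤ) ⊆ vertices (link (pureSkeleton C i) p) ∧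
            (P.2 : Set ℤ) ⊆ vertices (link (pureSkeleton C i) p)) ∧
          B.map (fun P => emb K (zPoly K P.1.val P.2.val)) =
            nonzeroPart (upDownSpectrum K (link (pureSkeleton C i) p) (i - 2))) ∧
        ∀ A B : Multiset (Finset ℤ × Finset ℤ),
          (∀ P ∈ A, (∀ s ∈ P.1, p < s) ∧ (∀ t ∈ P.2, p < t)) →
          (∀ P ∈ B, (∀ s ∈ P.1, p < s) ∧ (∀ t ∈ P.2, p < t)) →
          A.map (fun P => emb K (zPoly K P.1.val P.2.val)) =
            nonzeroPart (upDownSpectrum K (deletion (pureSkeleton C i) p) (i - 1)) →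
          B.map (fun P => emb K (zPoly K P.1.val P.2.val)) =
            nonzeroPart (upDownSpectrum K (link (pureSkeleton C i) p) (i - 2)) →
          EqUpToZero (upDownSpectrum K C (i - 1))
            (A.map (fun P => emb K (raisePow K (dimension C - i)
                (zPoly K P.1.val (insert p P.2).val))) +
              B.map (fun P => emb K (raisePow K (dimension C - i)
                (zPoly K (insert p P.1).val (insert p P.2).val))) +
              Multiset.replicate (bettiSucc (deletion (pureSkeleton C i) p) (i - 2))
                (emb K (raisePow K (dimension C - i) (zPoly K ∅ {p}))))) := by
  refine ⟨fun i r hr hr0 => hC.exists_zPoly_of_mem_upDownSpectrum K hr hr0,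
    fun hv i r hr => hC.eq_zero_of_mem_upDownSpectrum K hv hr, fun i h0 hi => ?_⟩
  have hne := hC.facesOfDim_nonempty h0 hi
  have hS := hC.pureSkeleton hne
  have hle : ∀ F ∈ pureSkeleton C i, (F.card : ℤ) ≤ i + 1 :=
    fun _ => card_le_of_mem_pureSkeleton
  have ha := hS.isLeast_vertices (exists_nonempty_mem_pureSkeleton h0 hne)
  refine ⟨a, ha, hS.deletion.exists_map_zPoly_eq_nonzeroPart K (hS.card_le_of_mem_deletion hle),
    ?_, fun A B hA hB hdel hlink => eqUpToZero_of_nonzeroPart_eq ?_⟩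
  · rw [show i - 2 = i - 1 - 1 by ring]
    exact (hS.link ha.1).exists_map_zPoly_eq_nonzeroPart K (hS.card_le_of_mem_link hle)
  · rw [hC.nonzeroPart_upDownSpectrum_eq_apexRecurrence K hne ha.1 hA hB hdel hlink,
      apexRecurrence, Multiset.map_add, Multiset.map_add, Multiset.map_map, Multiset.map_map,
      Multiset.map_replicate]
    rfl

theorem theorem7p2 (K : Type*) [Field K] [CharZero K] (C : Finset (Finset ℤ)) (a b : ℤ)
    (hC : IsShiftedComplex C a b) :
    -- every nonzero eigenvalue is a raised z-polynomial
    (∀ i : ℤ, ∀ r ∈ upDownSpectrum K C (i - 1), r ≠ 0 →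
      ∃ S T : Finset ℤ, (S : Set ℤ) ⊆ vertices C ∧ (T : Set ℤ) ⊆ vertices C ∧
        r = emb K (raisePow K (dimension C - i) (zPoly K S.val T.val))) ∧
    -- a complex without vertices has no nonzero eigenvalues
    (vertices C = ∅ → ∀ i : ℤ, ∀ r ∈ upDownSpectrum K C (i - 1), r = 0) ∧
    -- the pure skeleton has an initial vertex, and the recurrence holds
    (∀ i : ℤ, 0 ≤ i → i ≤ dimension C →
      ∃ p : ℤ, IsLeast (vertices (pureSkeleton C i)) p ∧
        -- the nonzero eigenvalues of the deletion are z-polynomials, with no raising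
        (∃ A : Multiset (Finset ℤ × Finset ℤ),
          (∀ P ∈ A, (P.1 : Set ℤ) ⊆ vertices (deletion (pureSkeleton C i) p) ∧
            (P.2 : Set ℤ) ⊆ vertices (deletion (pureSkeleton C i) p)) ∧
          A.map (fun P => emb K (zPoly K P.1.val P.2.val)) =
            nonzeroPart (upDownSpectrum K (deletion (pureSkeleton C i) p) (i - 1))) ∧
        -- the nonzero eigenvalues of the link are z-polynomials, with no raising
        (∃ B : Multiset (Finset ℤ × Finset ℤ),
          (∀ P ∈ B, (P.1 : Set ℤ) ⊆ vertices (link (pureSkeleton C i) p) ∧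
            (P.2 : Set ℤ) ⊆ vertices (link (pureSkeleton C i) p)) ∧
          B.map (fun P => emb K (zPoly K P.1.val P.2.val)) =
            nonzeroPart (upDownSpectrum K (link (pureSkeleton C i) p) (i - 2))) ∧
        -- the recurrence, for every way of writing these eigenvalues as z-polynomials
        ∀ A B : Multiset (Finset ℤ × Finset ℤ),
          (∀ P ∈ A, (∀ s ∈ P.1, p < s) ∧ (∀ t ∈ P.2, p < t)) →
          (∀ P ∈ B, (∀ s ∈ P.1, p < s) ∧ (∀ t ∈ P.2, p < t)) →
          A.map (fun P => emb K (zPoly K P.1.val P.2.val)) =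
            nonzeroPart (upDownSpectrum K (deletion (pureSkeleton C i) p) (i - 1)) →
          B.map (fun P => emb K (zPoly K P.1.val P.2.val)) =
            nonzeroPart (upDownSpectrum K (link (pureSkeleton C i) p) (i - 2)) →
          EqUpToZero (upDownSpectrum K C (i - 1))
            (A.map (fun P => emb K (raisePow K (dimension C - i)
                (zPoly K P.1.val (insert p P.2).val))) +
              B.map (fun P => emb K (raisePow K (dimension C - i)
                (zPoly K (insert p P.1).val (insert p P.2).val))) +
              Multiset.replicate (bettiSucc (deletion (pureSkeleton C i) p) (i - 2))
                (emb K (raisePow K (dimension C - i) (zPoly K ∅ {p}))))) :=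
  theorem7p2_general K C a b hC
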